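/- **Theorem (Approximate solutions of the optimal transport problem with independent marginals).** For $K,L\ge 1$ let $\mu=\otimes_{k=1}^K\mu_k$ with $\mu_k=\sum_{l=1}^L\mu_k^l\,\delta_{x_k^l}$ be a product of $K$ univariate discrete probability distributions, let $\nu_t=t\,\delta_{y_1}+(1-t)\,\delta_{y_2}$ with $y_1,y_2\in\mathbb Q^K$ and $t\in[0,1]$, and let $\varepsilon>0$ be a rational error tolerance. For the cost $c(x,y)=\|x-y\|^2$ (squared Euclidean distance) let $$W_c(\mu,\nu_t)=\min\Big\{\sum_{i}\sum_{j=1}^{2}c(x_i,y_j)\,\pi_{ij}\;:\;\pi\ge 0,\ \sum_j\pi_{ij}=\mu_i\ \forall i,\ \sum_i\pi_{i1}=t,\ \sum_i\pi_{i2}=1-t\Big\},$$ where $i$ runs over the $L^K$ atoms $x_i=(x_1^{i_1},\dots,x_K^{i_K})$ of $\mu$, of probability $\mu_i=\prod_k\mu_k^{i_k}$. Suppose that all probabilities $\mu_k^l,t,1-t$ and all coordinates $x_k^l,y_{1,k},y_{2,k}$ are fractions of two integers with absolute values at most $U\in\mathbb N$. There is one algorithm (a fixed program, independent of the instance, of a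 random access machine over $\mathbb Q$ whose operations are addition, subtraction, multiplication, division, rounding down to an integer, comparison, assignment and array access) that, given $K,L,(\mu_k^l),(x_k^l),y_1,y_2,t,\varepsilon$, outputs a number $\widetilde W$ with $|\widetilde W-W_c(\mu,\nu_t)|\le\varepsilon$ and for which the following bounds hold. 1. The number of operations is $$\mathcal O\big(KL\log_2(KL)+K^6U^8/\varepsilon^4+1\big),$$ with an absolute implied constant. 2. The bit lengths of all numbers computed by the algorithm are bounded by a fixed polynomial in $K$, $L$, $\log_2 U$ and $\max\{0,\log_2(1/\varepsilon)\}$. -/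

import Mathlib

/-! ### Optimal transport between finitely supported distributions -/

/-- The transport polytope `Π(μ, ν)`: nonnegative matrices with row sums `μ` and column sums `ν`. -/
def transportPlans {I J : Type*} [Fintype I] [Fintype J] (μ : I → ℝ) (ν : J → ℝ) :
    Set (I → J → ℝ) :=
  {π | (∀ i j, 0 ≤ π i j) ∧ (∀ i, ∑ j, π i j = μ i) ∧ (∀ j, ∑ i, π i j = ν j)}

/-- The optimal transport distance `W_c(μ, ν)` between `μ = ∑ i, μ i • δ_{x i}` and
`ν = ∑ j, ν j • δ_{y j}`: the optimal value of the transportation linear program. -/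
noncomputable def optimalTransport {E I J : Type*} [Fintype I] [Fintype J] (c : E → E → ℝ)
    (μ : I → ℝ) (x : I → E) (ν : J → ℝ) (y : J → E) : ℝ :=
  sInf ((fun π : I → J → ℝ => ∑ i, ∑ j, c (x i) (y j) * π i j) '' transportPlans μ ν)

/-- The rational vector `v`, seen as a point of the Euclidean space `ℝ^K`. -/
noncomputable def ratPoint {K : ℕ} (v : Fin K → ℚ) : EuclideanSpace ℝ (Fin K) :=
  WithLp.toLp 2 (fun k => (v k : ℝ))

/-- `W_c(μ, ν_t)` for the squared Euclidean cost, where `μ` is the product of the `K` univariate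
marginals `μ_k = ∑ l, p k l • δ_{x k l}` and `ν_t = t • δ_{y₁} + (1 - t) • δ_{y₂}`. The atoms of `μ`
are indexed by the `L ^ K` maps `i : Fin K → Fin L`. -/
noncomputable def productTwoPointOT {K L : ℕ} (p x : Fin K → Fin L → ℚ) (y₁ y₂ : Fin K → ℚ)
    (t : ℚ) : ℝ :=
  optimalTransport (fun u v : EuclideanSpace ℝ (Fin K) => ‖u - v‖ ^ 2)
    (fun i : Fin K → Fin L => ∏ k, (p k (i k) : ℝ))
    (fun i : Fin K → Fin L => ratPoint (fun k => x k (i k)))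
    ![(t : ℝ), 1 - (t : ℝ)]
    ![ratPoint y₁, ratPoint y₂]

/-! ### Sizes of rational numbers -/

/-- `q` is a fraction of two integers with absolute values at most `U`. -/
def IsFractionBoundedBy (U : ℕ) (q : ℚ) : Prop :=
  ∃ a b : ℤ, b ≠ 0 ∧ |a| ≤ (U : ℤ) ∧ |b| ≤ (U : ℤ) ∧ q = (a : ℚ) / (b : ℚ)

/-- Number of binary digits of numerator and denominator of `q` in lowest terms. -/
def bitLength (q : ℚ) : ℕ := q.num.natAbs.size + q.den.size

/-! ### A random access machine over the rational numbers

The memory consists of registers `r 0, r 1, …` and arrays `A 0, A 1, …`, each cell of which holds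
one rational number. A program is a fixed finite text: it can depend neither on the size nor
on the data of the instance it is run on. -/

namespace RatRam

/-- A memory configuration: contents of the registers and of the cells of the arrays. -/
structure State where
  reg : ℕ → ℚ
  arr : ℕ → ℕ → ℚ

/-- Memory after writing `q` to register `r`. -/
def State.setReg (s : State) (r : ℕ) (q : ℚ) : State where
  reg := Function.update s.reg r q
  arr := s.arr

/-- Memory after writing `q` to cell `n` of array `a`. -/
def State.setCell (s : State) (a n : ℕ) (q : ℚ) : State where
  reg := s.reg
  arr := Function.update s.arr a (Function.update (s.arr a) n q)

/-- The four binary arithmetic operations (with the convention `a / 0 = 0`). -/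
inductive BinOp
  | add
  | sub
  | mul
  | div

/-- The result of a binary arithmetic operation. -/
def BinOp.apply : BinOp → ℚ → ℚ → ℚ
  | .add, a, b => a + b
  | .sub, a, b => a - b
  | .mul, a, b => a * b
  | .div, a, b => a / b

/-- Expressions: rational literals, registers, array cells `A a [e]`, arithmetic operations, and
rounding down to an integer. -/
inductive Term
  | const (q : ℚ)
  | reg (r : ℕ)
  | cell (a : ℕ) (e : Term)
  | bin (o : BinOp) (e f : Term)
  | floor (e : Term)

/-- The value of an expression. The address of an array cell is meant to be a natural number;
other values are rounded down (negative ones to `0`). -/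
def Term.eval (s : State) : Term → ℚ
  | .const q => q
  | .reg r => s.reg r
  | .cell a e => s.arr a ⌊e.eval s⌋₊
  | .bin o e f => o.apply (e.eval s) (f.eval s)
  | .floor e => (⌊e.eval s⌋ : ℚ)

/-- The number of operations (array accesses, arithmetic operations, roundings) in the evaluation of
an expression. -/
def Term.cost : Term → ℕ
  | .const _ => 0
  | .reg _ => 0
  | .cell _ e => e.cost + 1
  | .bin _ e f => e.cost + f.cost + 1
  | .floor e => e.cost + 1

/-- The results of all arithmetic operations and roundings in the evaluation of an expression. -/
def Term.computed (s : State) : Term → List ℚ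
  | .const _ => []
  | .reg _ => []
  | .cell _ e => e.computed s
  | .bin o e f => e.computed s ++ f.computed s ++ [o.apply (e.eval s) (f.eval s)]
  | .floor e => e.computed s ++ [(⌊e.eval s⌋ : ℚ)]

/-- Programs: `assign r e` is `r := e`; `store a i e` is `A a [i] := e`; `branch e f c d` is
`if e < f then c else d`; `loop e f c` is `while e < f do c`. -/
inductive Program
  | skip
  | assign (r : ℕ) (e : Term)
  | store (a : ℕ) (i e : Term)
  | seq (c d : Program)
  | branch (e f : Term) (c d : Program)
  | loop (e f : Term) (c : Program)

/-- `Run c s n T s'`: started in memory `s`, the program `c` halts in memory `s'` after exactly `n`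
operations (arithmetic operations, roundings, array accesses, assignments and comparisons all
count), and `T` lists all numbers that it computes (results of operations) or writes to memory. -/
inductive Run : Program → State → ℕ → List ℚ → State → Prop
  | skip (s : State) : Run .skip s 0 [] s
  | assign (r : ℕ) (e : Term) (s : State) :
      Run (.assign r e) s (e.cost + 1) (e.computed s ++ [e.eval s])
        (s.setReg r (e.eval s))
  | store (a : ℕ) (i e : Term) (s : State) :
      Run (.store a i e) s (i.cost + e.cost + 1) (i.computed s ++ e.computed s ++ [e.eval s])
        (s.setCell a ⌊i.eval s⌋₊ (e.eval s))
  | seq {c d : Program} {s s' s'' : State} {m n : ℕ} {T T' : List ℚ}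
      (hc : Run c s m T s') (hd : Run d s' n T' s'') :
      Run (.seq c d) s (m + n) (T ++ T') s''
  | branch_true {e f : Term} {c d : Program} {s s' : State} {n : ℕ} {T : List ℚ}
      (h : e.eval s < f.eval s) (hc : Run c s n T s') :
      Run (.branch e f c d) s (e.cost + f.cost + 1 + n) (e.computed s ++ f.computed s ++ T) s'
  | branch_false {e f : Term} {c d : Program} {s s' : State} {n : ℕ} {T : List ℚ}
      (h : ¬ e.eval s < f.eval s) (hd : Run d s n T s') :
      Run (.branch e f c d) s (e.cost + f.cost + 1 + n) (e.computed s ++ f.computed s ++ T) s'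
  | loop_true {e f : Term} {c : Program} {s s' s'' : State} {m n : ℕ} {T T' : List ℚ}
      (h : e.eval s < f.eval s) (hc : Run c s m T s') (hl : Run (.loop e f c) s' n T' s'') :
      Run (.loop e f c) s (e.cost + f.cost + 1 + m + n)
        (e.computed s ++ f.computed s ++ T ++ T') s''
  | loop_false {e f : Term} {c : Program} {s : State}
      (h : ¬ e.eval s < f.eval s) :
      Run (.loop e f c) s (e.cost + f.cost + 1) (e.computed s ++ f.computed s) s

/-- The memory holding an instance: registers `0, 1, 2, 3` hold `K, L, t, ε`; the cells `k * L + l` of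
the arrays `0` and `1` hold `p k l` and `x k l`; the cells `k` of the arrays `2` and `3` hold `y₁ k` and
`y₂ k` (indices counted from `0`). Everything else is `0`. -/
def inputState {K L : ℕ} (p x : Fin K → Fin L → ℚ) (y₁ y₂ : Fin K → ℚ) (t ε : ℚ) : State where
  reg r :=
    match r with
    | 0 => (K : ℚ)
    | 1 => (L : ℚ)
    | 2 => t
    | 3 => ε
    | _ => 0
  arr a n :=
    match a with
    | 0 => if h : n < K * L then
        p (finProdFinEquiv.symm ⟨n, h⟩).1 (finProdFinEquiv.symm ⟨n, h⟩).2 else 0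
    | 1 => if h : n < K * L then
        x (finProdFinEquiv.symm ⟨n, h⟩).1 (finProdFinEquiv.symm ⟨n, h⟩).2 else 0
    | 2 => if h : n < K then y₁ ⟨n, h⟩ else 0
    | 3 => if h : n < K then y₂ ⟨n, h⟩ else 0
    | _ => 0

/-- The output of a halted computation is the content of register `4`. -/
def State.output (s : State) : ℚ := s.reg 4

end RatRam

/-! A plan is determined by its first column φ, where 0 ≤ φ ≤ μ and φ has total mass t. Its cost is
the mean squared distance to y₂ plus the sum of φ times the cost difference c(x, y₁) - c(x, y₂).
Minimizing it is a fractional knapsack problem: the smallest differences are filled first. The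
difference is a sum of K one-coordinate gaps, each at most V in absolute value. Rounding every gap
down to a grid of mesh V/N changes the difference by at most KV/N ≤ ε, hence the optimal value by at
most ε, because φ has mass at most 1. After rounding, only the law of an integer S between 0 and M =
2NK matters. In ∑ φ S = M t - ∑_{s < M} φ(S ≤ s), each φ(S ≤ s) is at most min(t, μ(S ≤ s)), and one
greedy φ attains all these bounds simultaneously (`exists_greedy`, `abs_optimalTransport_sub_le`).

By independence of the coordinates, the law of S is a K-fold convolution (`sumMass_eq`), so O(K²N²)
operations replace the sum over L^K atoms. By linearity, the mean distance to y₂ needs one pass over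
the KL one-dimensional atoms. The resolution N is found by doubling, so N = 1 or N ≤ 2KV/ε, where V
≤ 8U². If KV ≤ ε, the optimal value lies in [0, KV] and the answer 0 suffices. Otherwise w = KU²/ε
is at least 1/8, so N is at most 16w, and K²N² is at most a constant times K²w⁴ = K⁶U⁸/ε⁴.

Bit lengths need care, since adding fractions one by one lets the estimated denominators grow with
the length of the loops. All masses in the convolution are, however, integer multiples of one over
the product of the denominators of the input probabilities, and they lie in [0, 1]. Such numbers are
short however they were computed (`FitsBits.of_mul_eq_intCast`, `sumMass_integral`). Programs are
treated with `Achieves`, a Hoare triple that also records time and bit length. -/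

/-! ### Numbers of bounded bit length -/

/-- `q` is a fraction whose numerator and denominator are at most `2 ^ b`. -/
def FitsBits (b : ℕ) (q : ℚ) : Prop :=
  ∃ (z : ℤ) (d : ℕ), 0 < d ∧ |z| ≤ 2 ^ b ∧ d ≤ 2 ^ b ∧ q = z / d

namespace FitsBits

variable {a b c : ℕ} {q r : ℚ}

theorem mono (h : FitsBits a q) (hab : a ≤ b) : FitsBits b q := by
  obtain ⟨z, d, hd, hz, hd', rfl⟩ := h
  exact ⟨z, d, hd, hz.trans (pow_le_pow_right₀ (by norm_num) hab),
    hd'.trans (Nat.pow_le_pow_right (by norm_num) hab), rfl⟩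

/-- The defining fraction need not be reduced, which makes the closure properties immediate; passing
to lowest terms only replaces numerator and denominator by divisors. -/
theorem den_le (h : FitsBits b q) : q.den ≤ 2 ^ b := by
  obtain ⟨z, d, hd, -, hd', rfl⟩ := h
  refine le_trans (Nat.le_of_dvd hd ?_) hd'
  have := Rat.den_dvd z d
  rw [Rat.divInt_eq_div, Int.cast_natCast] at this
  exact_mod_cast this

theorem natAbs_num_le (h : FitsBits b q) : q.num.natAbs ≤ 2 ^ b := by
  obtain ⟨z, d, hd, hz, -, rfl⟩ := h
  have hd0 : (d : ℤ) ≠ 0 := by exact_mod_cast hd.ne'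
  rcases eq_or_ne z 0 with rfl | hz0
  · simp
  have h1 : ((z : ℚ) / d).num ∣ z := by
    have := Rat.num_dvd z hd0
    rwa [Rat.divInt_eq_div, Int.cast_natCast] at this
  have h2 := Nat.le_of_dvd (Int.natAbs_pos.2 hz0) (Int.natAbs_dvd_natAbs.2 h1)
  refine h2.trans ?_
  zify
  exact hz

theorem bitLength_le (h : FitsBits b q) : bitLength q ≤ 2 * b + 2 := by
  have h1 : q.num.natAbs.size ≤ b + 1 :=
    Nat.size_le.2 (h.natAbs_num_le.trans_lt (Nat.pow_lt_pow_right (by norm_num) (by omega)))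
  have h2 : q.den.size ≤ b + 1 :=
    Nat.size_le.2 (h.den_le.trans_lt (Nat.pow_lt_pow_right (by norm_num) (by omega)))
  unfold bitLength
  omega

theorem natCast {n : ℕ} (h : n ≤ 2 ^ b) : FitsBits b (n : ℚ) :=
  ⟨n, 1, one_pos, by simpa using (by exact_mod_cast h : (n : ℤ) ≤ 2 ^ b), Nat.one_le_two_pow,
    by simp⟩

theorem zero : FitsBits b 0 := by
  simpa using natCast (n := 0) (b := b) (by positivity)

theorem one : FitsBits b 1 := by
  simpa using natCast (n := 1) (b := b) Nat.one_le_two_pow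

theorem add (hq : FitsBits a q) (hr : FitsBits b r) : FitsBits (a + b + 1) (q + r) := by
  obtain ⟨z, d, hd, hz, hd', rfl⟩ := hq
  obtain ⟨w, e, he, hw, he', rfl⟩ := hr
  refine ⟨z * e + w * d, d * e, by positivity, ?_, ?_, ?_⟩
  · have h1 : |z * e| ≤ 2 ^ a * 2 ^ b := by
      rw [abs_mul]
      refine mul_le_mul hz ?_ (abs_nonneg _) (by positivity)
      rw [Nat.abs_cast]
      exact_mod_cast he'
    have h2 : |w * d| ≤ 2 ^ b * 2 ^ a := by
      rw [abs_mul]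
      refine mul_le_mul hw ?_ (abs_nonneg _) (by positivity)
      rw [Nat.abs_cast]
      exact_mod_cast hd'
    calc |z * e + w * d| ≤ |z * e| + |w * d| := abs_add_le _ _
      _ ≤ 2 ^ a * 2 ^ b + 2 ^ b * 2 ^ a := add_le_add h1 h2
      _ = 2 ^ (a + b + 1) := by ring
  · calc d * e ≤ 2 ^ a * 2 ^ b := Nat.mul_le_mul hd' he'
      _ = 2 ^ (a + b) := (pow_add _ _ _).symm
      _ ≤ _ := Nat.pow_le_pow_right (by norm_num) (by omega)
  · have : (d : ℚ) ≠ 0 := by exact_mod_cast hd.ne'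
    have : (e : ℚ) ≠ 0 := by exact_mod_cast he.ne'
    push_cast
    field_simp

theorem neg (hq : FitsBits a q) : FitsBits a (-q) := by
  obtain ⟨z, d, hd, hz, hd', rfl⟩ := hq
  exact ⟨-z, d, hd, by simpa using hz, hd', by push_cast; ring⟩

theorem sub (hq : FitsBits a q) (hr : FitsBits b r) : FitsBits (a + b + 1) (q - r) := by
  rw [sub_eq_add_neg]
  exact hq.add hr.neg

theorem mul (hq : FitsBits a q) (hr : FitsBits b r) : FitsBits (a + b) (q * r) := by
  obtain ⟨z, d, hd, hz, hd', rfl⟩ := hq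
  obtain ⟨w, e, he, hw, he', rfl⟩ := hr
  refine ⟨z * w, d * e, by positivity, ?_, ?_, ?_⟩
  · rw [abs_mul, pow_add]
    exact mul_le_mul hz hw (abs_nonneg _) (by positivity)
  · rw [pow_add]
    exact Nat.mul_le_mul hd' he'
  · push_cast
    rw [div_mul_div_comm]

theorem inv (hq : FitsBits a q) : FitsBits a q⁻¹ := by
  obtain ⟨z, d, hd, hz, hd', rfl⟩ := hq
  rcases lt_trichotomy z 0 with h | rfl | h
  · refine ⟨-d, z.natAbs, by omega, by simpa using (by exact_mod_cast hd'), ?_, ?_⟩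
    · zify
      exact hz
    · have : ((z.natAbs : ℕ) : ℚ) = -z := by
        rw [Nat.cast_natAbs, abs_of_neg h, Int.cast_neg]
      rw [this, inv_div]
      push_cast
      rw [neg_div_neg_eq]
  · simpa using zero
  · refine ⟨d, z.natAbs, by omega, by simpa using (by exact_mod_cast hd'), ?_, ?_⟩
    · zify
      exact hz
    · have : ((z.natAbs : ℕ) : ℚ) = z := by
        rw [Nat.cast_natAbs, abs_of_pos h]
      rw [this, inv_div]
      push_cast
      rfl

theorem div (hq : FitsBits a q) (hr : FitsBits b r) : FitsBits (a + b) (q / r) := by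
  rw [div_eq_mul_inv]
  exact hq.mul hr.inv

theorem sum {f : ℕ → ℚ} (hf : ∀ i, FitsBits a (f i)) (n : ℕ) :
    FitsBits (n * (a + 1)) (∑ i ∈ Finset.range n, f i) := by
  induction n with
  | zero => simpa using zero
  | succ n ih =>
    rw [Finset.sum_range_succ]
    exact (ih.add (hf n)).mono (by rw [Nat.succ_mul]; omega)

/-- The bound depends only on a denominator and the magnitude of the number, not on the number of
operations that produced it. This keeps long sums short. -/
theorem of_mul_eq_intCast {d : ℕ} {z : ℤ} (hd : 0 < d) (hd' : d ≤ 2 ^ a) (hz : q * d = z)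
    (hq : |q| ≤ 2 ^ b) : FitsBits (a + b) q := by
  have hd0 : (d : ℚ) ≠ 0 := by exact_mod_cast hd.ne'
  refine ⟨z, d, hd, ?_, hd'.trans (Nat.pow_le_pow_right (by norm_num) (by omega)), ?_⟩
  · have : |(z : ℚ)| ≤ 2 ^ (a + b) := by
      rw [← hz, abs_mul, pow_add, mul_comm, Nat.abs_cast]
      exact mul_le_mul (by exact_mod_cast hd') hq (abs_nonneg _) (by positivity)
    exact_mod_cast this
  · rw [← hz]
    field_simp

end FitsBits

theorem IsFractionBoundedBy.fitsBits {U u : ℕ} {q : ℚ} (h : IsFractionBoundedBy U q)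
    (hU : U ≤ 2 ^ u) : FitsBits u q := by
  obtain ⟨a, b, hb, ha, hb', rfl⟩ := h
  have hU' : (U : ℤ) ≤ 2 ^ u := by exact_mod_cast hU
  -- `IsFractionBoundedBy` admits negative denominators, `FitsBits` does not; the sign moves to the
  -- numerator.
  have hint : ∀ z : ℤ, |z| ≤ 2 ^ u → z ≠ 0 → FitsBits u ((a : ℚ) / z) := by
    intro z hz hz0
    rcases lt_or_gt_of_ne hz0 with h | h
    · refine ⟨-a, z.natAbs, by omega, by simpa using ha.trans hU', ?_, ?_⟩
      · zify
        exact hz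
      · have : ((z.natAbs : ℕ) : ℚ) = -z := by
          rw [Nat.cast_natAbs, abs_of_neg h, Int.cast_neg]
        rw [this]
        push_cast
        rw [neg_div_neg_eq]
    · refine ⟨a, z.natAbs, by omega, ha.trans hU', ?_, ?_⟩
      · zify
        exact hz
      · have : ((z.natAbs : ℕ) : ℚ) = z := by
          rw [Nat.cast_natAbs, abs_of_pos h]
        rw [this]
  exact hint b (hb'.trans hU') hb

/-! ### Reasoning about programs -/

namespace RatRam

instance : Add Term := ⟨.bin .add⟩
instance : Sub Term := ⟨.bin .sub⟩
instance : Mul Term := ⟨.bin .mul⟩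
instance : Div Term := ⟨.bin .div⟩

section Term
variable (s : State) (e f : Term)

@[simp] theorem Term.eval_const (q : ℚ) : (Term.const q).eval s = q := rfl
@[simp] theorem Term.eval_reg (r : ℕ) : (Term.reg r).eval s = s.reg r := rfl
@[simp] theorem Term.eval_cell (a : ℕ) : (Term.cell a e).eval s = s.arr a ⌊e.eval s⌋₊ := rfl
@[simp] theorem Term.eval_add : (e + f).eval s = e.eval s + f.eval s := rfl
@[simp] theorem Term.eval_sub : (e - f).eval s = e.eval s - f.eval s := rfl
@[simp] theorem Term.eval_mul : (e * f).eval s = e.eval s * f.eval s := rfl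
@[simp] theorem Term.eval_div : (e / f).eval s = e.eval s / f.eval s := rfl
@[simp] theorem Term.cost_const (q : ℚ) : (Term.const q).cost = 0 := rfl
@[simp] theorem Term.cost_reg (r : ℕ) : (Term.reg r).cost = 0 := rfl
@[simp] theorem Term.cost_cell (a : ℕ) : (Term.cell a e).cost = e.cost + 1 := rfl
@[simp] theorem Term.cost_add : (e + f).cost = e.cost + f.cost + 1 := rfl
@[simp] theorem Term.cost_sub : (e - f).cost = e.cost + f.cost + 1 := rfl
@[simp] theorem Term.cost_mul : (e * f).cost = e.cost + f.cost + 1 := rfl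
@[simp] theorem Term.cost_div : (e / f).cost = e.cost + f.cost + 1 := rfl
@[simp] theorem Term.computed_const (q : ℚ) : (Term.const q).computed s = [] := rfl
@[simp] theorem Term.computed_reg (r : ℕ) : (Term.reg r).computed s = [] := rfl
@[simp] theorem Term.computed_cell (a : ℕ) : (Term.cell a e).computed s = e.computed s := rfl
@[simp] theorem Term.computed_add :
    (e + f).computed s = e.computed s ++ f.computed s ++ [e.eval s + f.eval s] := rfl
@[simp] theorem Term.computed_sub :
    (e - f).computed s = e.computed s ++ f.computed s ++ [e.eval s - f.eval s] := rfl
@[simp] theorem Term.computed_mul :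
    (e * f).computed s = e.computed s ++ f.computed s ++ [e.eval s * f.eval s] := rfl
@[simp] theorem Term.computed_div :
    (e / f).computed s = e.computed s ++ f.computed s ++ [e.eval s / f.eval s] := rfl

end Term

section State
variable (s : State)

@[simp] theorem State.reg_setReg (r r' : ℕ) (q : ℚ) :
    (s.setReg r q).reg r' = if r' = r then q else s.reg r' := by
  simp [State.setReg, Function.update_apply]

@[simp] theorem State.arr_setReg (r : ℕ) (q : ℚ) : (s.setReg r q).arr = s.arr := rfl

@[simp] theorem State.reg_setCell (a n : ℕ) (q : ℚ) : (s.setCell a n q).reg = s.reg := rfl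

@[simp] theorem State.arr_setCell_same (a n : ℕ) (q : ℚ) :
    (s.setCell a n q).arr a = Function.update (s.arr a) n q := by
  simp [State.setCell]

theorem State.arr_setCell_of_ne {a a' : ℕ} (h : a' ≠ a) (n : ℕ) (q : ℚ) :
    (s.setCell a n q).arr a' = s.arr a' := by
  simp [State.setCell, h]

end State

/-- Started in `s`, the program `c` halts after at most `n` operations in a memory satisfying `Post`,
and all numbers that it computes fit into `b` bits. -/
def Achieves (b : ℕ) (c : Program) (s : State) (n : ℕ) (Post : State → Prop) : Prop :=
  ∃ m ≤ n, ∃ T s', Run c s m T s' ∧ (∀ q ∈ T, FitsBits b q) ∧ Post s'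

namespace Achieves

variable {b n n' : ℕ} {c d : Program} {s : State} {Post Mid : State → Prop}

theorem mono (h : Achieves b c s n Mid) (hn : n ≤ n') (hP : ∀ s', Mid s' → Post s') :
    Achieves b c s n' Post := by
  obtain ⟨m, hm, T, s', hr, hT, hs⟩ := h
  exact ⟨m, hm.trans hn, T, s', hr, hT, hP _ hs⟩

theorem skip (h : Post s) : Achieves b .skip s 0 Post :=
  ⟨0, le_rfl, [], s, .skip s, by simp, h⟩

theorem assign {r : ℕ} {e : Term} (hT : ∀ q ∈ e.computed s ++ [e.eval s], FitsBits b q)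
    (hP : Post (s.setReg r (e.eval s))) : Achieves b (.assign r e) s (e.cost + 1) Post :=
  ⟨_, le_rfl, _, _, .assign r e s, hT, hP⟩

theorem store {a : ℕ} {i e : Term}
    (hT : ∀ q ∈ i.computed s ++ e.computed s ++ [e.eval s], FitsBits b q)
    (hP : Post (s.setCell a ⌊i.eval s⌋₊ (e.eval s))) :
    Achieves b (.store a i e) s (i.cost + e.cost + 1) Post :=
  ⟨_, le_rfl, _, _, .store a i e s, hT, hP⟩

theorem seq (hc : Achieves b c s n Mid) (hd : ∀ s', Mid s' → Achieves b d s' n' Post) :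
    Achieves b (.seq c d) s (n + n') Post := by
  obtain ⟨m, hm, T, s', hr, hT, hs⟩ := hc
  obtain ⟨m', hm', T', s'', hr', hT', hs'⟩ := hd s' hs
  refine ⟨m + m', by omega, T ++ T', s'', hr.seq hr', ?_, hs'⟩
  intro q hq
  rcases List.mem_append.1 hq with h | h
  exacts [hT q h, hT' q h]

theorem branch {e f : Term} (hT : ∀ q ∈ e.computed s ++ f.computed s, FitsBits b q)
    (hc : e.eval s < f.eval s → Achieves b c s n Post)
    (hd : ¬ e.eval s < f.eval s → Achieves b d s n Post) :
    Achieves b (.branch e f c d) s (e.cost + f.cost + 1 + n) Post := by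
  by_cases h : e.eval s < f.eval s
  · obtain ⟨m, hm, T, s', hr, hT', hs⟩ := hc h
    refine ⟨_, Nat.add_le_add_left hm _, _, s', .branch_true h hr, ?_, hs⟩
    intro q hq
    rcases List.mem_append.1 hq with h | h
    exacts [hT q h, hT' q h]
  · obtain ⟨m, hm, T, s', hr, hT', hs⟩ := hd h
    refine ⟨_, Nat.add_le_add_left hm _, _, s', .branch_false h hr, ?_, hs⟩
    intro q hq
    rcases List.mem_append.1 hq with h | h
    exacts [hT q h, hT' q h]

/-- A loop that compares two registers and runs `J` times, with invariant `I`. -/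
theorem loop {i k J : ℕ} (I : ℕ → State → Prop)
    (hlt : ∀ j < J, ∀ s, I j s → s.reg i < s.reg k) (hend : ∀ s, I J s → ¬ s.reg i < s.reg k)
    (hbody : ∀ j < J, ∀ s, I j s → Achieves b c s n (I (j + 1))) (h0 : I 0 s) :
    Achieves b (.loop (.reg i) (.reg k) c) s (J * (n + 1) + 1) (I J) := by
  -- The induction runs over the number `m` of remaining rounds, with the memory generalized. Each
  -- round costs its body and one comparison; the last, failing comparison is the extra 1.
  suffices H : ∀ m j s, j + m = J → I j s →
      Achieves b (.loop (.reg i) (.reg k) c) s (m * (n + 1) + 1) (I J) from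
    H J 0 s (by omega) h0
  intro m
  induction m with
  | zero =>
    intro j s hj hI
    obtain rfl : j = J := by omega
    exact ⟨1, by omega, [], s, .loop_false (hend s hI), by simp, hI⟩
  | succ m ih =>
    intro j s hj hI
    obtain ⟨m₁, hm₁, T₁, s₁, hr₁, hT₁, hI₁⟩ := hbody j (by omega) s hI
    obtain ⟨m₂, hm₂, T₂, s₂, hr₂, hT₂, hI₂⟩ := ih (j + 1) s₁ (by omega) hI₁
    refine ⟨_, ?_, _, s₂, .loop_true (hlt j (by omega) s hI) hr₁ hr₂, ?_, hI₂⟩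
    · simp only [Term.cost_reg]
      rw [Nat.succ_mul]
      omega
    · intro q hq
      simp only [Term.computed_reg, List.nil_append, List.mem_append] at hq
      rcases hq with h | h
      exacts [hT₁ q h, hT₂ q h]

end Achieves

/-- `while r i < r k do (c; r i := r i + 1)`. -/
def countLoop (i k : ℕ) (c : Program) : Program :=
  .loop (.reg i) (.reg k) (.seq c (.assign i (.reg i + .const 1)))

/-- The 3 additional operations per round are the comparison, the addition and the assignment of the
counter. The body has to leave the counter alone, and the invariant is required only after the
increment. -/
theorem Achieves.countLoop {b n : ℕ} {c : Program} {s : State} {i k J : ℕ} (I : ℕ → State → Prop)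
    (hI : ∀ j s, I j s → s.reg i = j ∧ s.reg k = J) (hJ : J ≤ 2 ^ b)
    (hbody : ∀ j < J, ∀ s, I j s →
      Achieves b c s n fun s' => s'.reg i = j ∧ I (j + 1) (s'.setReg i (j + 1)))
    (h0 : I 0 s) : Achieves b (countLoop i k c) s (J * (n + 3) + 1) (I J) := by
  refine Achieves.loop (n := n + 2) I ?_ ?_ ?_ h0
  · intro j hj s hs
    rw [(hI j s hs).1, (hI j s hs).2]
    exact_mod_cast hj
  · intro s hs
    rw [(hI J s hs).1, (hI J s hs).2]
    exact lt_irrefl _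
  · intro j hj s hs
    refine (hbody j hj s hs).seq (n' := 2) ?_
    rintro s' ⟨h1, h2⟩
    have hfit : FitsBits b ((j : ℚ) + 1) := by
      exact_mod_cast FitsBits.natCast (n := j + 1) (b := b) (by omega)
    refine Achieves.assign ?_ ?_
    · simpa [h1] using hfit
    · simpa [h1] using h2

end RatRam

/-! ### The data of an instance in flat form -/

/-- An instance as it is stored in memory: the atom `l` of the `k`-th marginal has index `k * L + l`. -/
structure FlatInstance where
  (K L : ℕ)
  (p x y z : ℕ → ℚ)
  (t ε : ℚ)

/-- Divisibility of the denominator of `q` in the form `q * d ∈ ℤ`. -/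
def IsIntegralMul (d : ℕ) (q : ℚ) : Prop := ∃ z : ℤ, q * d = z

namespace IsIntegralMul

variable {d e : ℕ} {q r : ℚ}

theorem zero : IsIntegralMul d 0 := ⟨0, by simp⟩

theorem add (hq : IsIntegralMul d q) (hr : IsIntegralMul d r) : IsIntegralMul d (q + r) := by
  obtain ⟨z, hz⟩ := hq
  obtain ⟨w, hw⟩ := hr
  exact ⟨z + w, by push_cast; rw [add_mul, hz, hw]⟩

theorem mul (hq : IsIntegralMul d q) (hr : IsIntegralMul e r) : IsIntegralMul (d * e) (q * r) := by
  obtain ⟨z, hz⟩ := hq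
  obtain ⟨w, hw⟩ := hr
  exact ⟨z * w, by push_cast; rw [← hz, ← hw]; ring⟩

theorem of_dvd (hq : IsIntegralMul d q) (h : d ∣ e) : IsIntegralMul e q := by
  obtain ⟨z, hz⟩ := hq
  obtain ⟨c, rfl⟩ := h
  exact ⟨z * c, by push_cast; rw [← hz]; ring⟩

theorem den (q : ℚ) : IsIntegralMul q.den q := ⟨q.num, Rat.mul_den_eq_num q⟩

theorem sum {ι : Type*} (s : Finset ι) {f : ι → ℚ} (h : ∀ i ∈ s, IsIntegralMul d (f i)) :
    IsIntegralMul d (∑ i ∈ s, f i) := by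
  classical
  induction s using Finset.induction_on with
  | empty => simpa using zero
  | insert a s ha ih =>
    rw [Finset.sum_insert ha]
    exact (h a (by simp)).add (ih fun i hi => h i (by simp [hi]))

end IsIntegralMul

namespace FlatInstance

variable (D : FlatInstance)

/-- `(x - y₁)² + (x - y₂)²` for the atom with index `n`. -/
def sqSum (n : ℕ) : ℚ :=
  (D.x n - D.y (n / D.L)) * (D.x n - D.y (n / D.L)) +
    (D.x n - D.z (n / D.L)) * (D.x n - D.z (n / D.L))

/-- `(x - y₁)² - (x - y₂)²` for the atom with index `n`. -/
def gap (n : ℕ) : ℚ :=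
  (D.x n - D.y (n / D.L)) * (D.x n - D.y (n / D.L)) -
    (D.x n - D.z (n / D.L)) * (D.x n - D.z (n / D.L))

/-- The expected squared distance to `y₂`, summed over the first `n` atoms. -/
def meanCost (n : ℕ) : ℚ :=
  ∑ i ∈ Finset.range n, D.p i * ((D.x i - D.z (i / D.L)) * (D.x i - D.z (i / D.L)))

/-- The grid point to which `gap n` is rounded, for a grid of `2 N + 1` points on `[-V, V]`. -/
def grid (V : ℚ) (N n : ℕ) : ℕ := ⌊D.gap n * N / V + N⌋₊

/-- The mass that the first `m` atoms of the `k`-th marginal give to the grid point `a`. -/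
def binMass (V : ℚ) (N k m a : ℕ) : ℚ :=
  ∑ l ∈ Finset.range m, if a = D.grid V N (k * D.L + l) then D.p (k * D.L + l) else 0

/-- The probability that the grid points of the first `k` marginals add up to `2 N K - j`. -/
def sumMass (V : ℚ) (N : ℕ) : ℕ → ℕ → ℚ
  | 0, j => if j = 2 * N * D.K then 1 else 0
  | k + 1, j => ∑ a ∈ Finset.range (2 * N + 1), D.binMass V N k D.L a * sumMass V N k (j + a)

/-- The probability that the grid points of all marginals add up to less than `j`. -/
def cumMass (V : ℚ) (N j : ℕ) : ℚ :=
  ∑ s ∈ Finset.range j, D.sumMass V N D.K (2 * N * D.K - s)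

/-- Sum of the truncated cumulative masses. -/
def truncSum (V : ℚ) (N j : ℕ) : ℚ := ∑ s ∈ Finset.range j, min D.t (D.cumMass V N (s + 1))

/-- The value computed for the instance. -/
def approxValue (V : ℚ) (N : ℕ) : ℚ :=
  D.meanCost (D.K * D.L) + V / N * (D.K * N * D.t - D.truncSum V N (2 * N * D.K))

/-- `V` is the maximum of `0` and the first `n` values of `sqSum`. -/
structure IsMaxSqSum (n : ℕ) (V : ℚ) : Prop where
  le : ∀ i < n, D.sqSum i ≤ V
  nonneg : 0 ≤ V
  eq : V = 0 ∨ ∃ i < n, V = D.sqSum i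

/-- The data are probabilities, and all numbers fit into `u` bits. -/
structure IsValid (u : ℕ) : Prop where
  K_pos : 0 < D.K
  L_pos : 0 < D.L
  p_nonneg : ∀ n, 0 ≤ D.p n
  p_sum : ∀ k < D.K, ∑ l ∈ Finset.range D.L, D.p (k * D.L + l) = 1
  t_nonneg : 0 ≤ D.t
  t_le : D.t ≤ 1
  p_fits : ∀ n, FitsBits u (D.p n)
  x_fits : ∀ n, FitsBits u (D.x n)
  y_fits : ∀ n, FitsBits u (D.y n)
  z_fits : ∀ n, FitsBits u (D.z n)
  t_fits : FitsBits u D.t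

variable {D}

theorem IsMaxSqSum.le_of {n : ℕ} {V W : ℚ} (hV : D.IsMaxSqSum n V) (hW : D.IsMaxSqSum n W) :
    V ≤ W := by
  rcases hV.eq with rfl | ⟨i, hi, rfl⟩
  exacts [hW.nonneg, hW.le i hi]

/-- Identifies the number found by the scan with the `V` fixed beforehand, in terms of which the
resolution is chosen. -/
theorem IsMaxSqSum.unique {n : ℕ} {V W : ℚ} (hV : D.IsMaxSqSum n V) (hW : D.IsMaxSqSum n W) :
    V = W :=
  le_antisymm (hV.le_of hW) (hW.le_of hV)

theorem IsMaxSqSum.succ_of_lt {n : ℕ} {V : ℚ} (hV : D.IsMaxSqSum n V) (h : V < D.sqSum n) :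
    D.IsMaxSqSum (n + 1) (D.sqSum n) := by
  refine ⟨fun i hi => ?_, hV.nonneg.trans h.le, Or.inr ⟨n, n.lt_succ_self, rfl⟩⟩
  rcases Nat.lt_succ_iff_lt_or_eq.1 hi with h' | rfl
  exacts [(hV.le i h').trans h.le, le_rfl]

theorem IsMaxSqSum.succ_of_le {n : ℕ} {V : ℚ} (hV : D.IsMaxSqSum n V) (h : D.sqSum n ≤ V) :
    D.IsMaxSqSum (n + 1) V := by
  refine ⟨fun i hi => ?_, hV.nonneg, hV.eq.imp_right fun ⟨i, hi, h⟩ => ⟨i, by omega, h⟩⟩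
  rcases Nat.lt_succ_iff_lt_or_eq.1 hi with h' | rfl
  exacts [hV.le i h', h]

variable (D) in
theorem exists_isMaxSqSum (n : ℕ) : ∃ V, D.IsMaxSqSum n V := by
  induction n with
  | zero => exact ⟨0, by simp, le_rfl, Or.inl rfl⟩
  | succ n ih =>
    obtain ⟨V, hV⟩ := ih
    rcases lt_or_ge V (D.sqSum n) with h | h
    exacts [⟨_, hV.succ_of_lt h⟩, ⟨_, hV.succ_of_le h⟩]

/-- A difference of nonnegative numbers is at most their sum in absolute value. The sum serves as
scale, instead of the largest gap, because it also bounds each of the two squares and thereby the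
cost itself. -/
theorem gap_abs_le (n : ℕ) : |D.gap n| ≤ D.sqSum n := by
  unfold gap sqSum
  rw [abs_le]
  constructor <;>
    nlinarith [mul_self_nonneg (D.x n - D.y (n / D.L)), mul_self_nonneg (D.x n - D.z (n / D.L))]

theorem grid_nonneg_aux {V : ℚ} (hV : 0 < V) (N : ℕ) {n : ℕ} (h : |D.gap n| ≤ V) :
    0 ≤ D.gap n * N / V + N ∧ D.gap n * N / V + N ≤ 2 * N := by
  have hN : (0 : ℚ) ≤ N := N.cast_nonneg
  obtain ⟨h1, h2⟩ := abs_le.1 h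
  have h3 : -(N : ℚ) ≤ D.gap n * N / V := by
    rw [le_div_iff₀ hV]
    nlinarith
  have h4 : D.gap n * N / V ≤ N := by
    rw [div_le_iff₀ hV]
    nlinarith
  constructor <;> linarith

theorem grid_le {V : ℚ} (hV : 0 < V) (N : ℕ) {n : ℕ} (h : |D.gap n| ≤ V) :
    D.grid V N n ≤ 2 * N := by
  refine Nat.floor_le_of_le ?_
  exact_mod_cast (grid_nonneg_aux hV N h).2

/-- Such cells stand for negative sums. The convolution loop does read beyond the top cell, where
the memory must therefore contain 0. -/
theorem sumMass_eq_zero (V : ℚ) (N k : ℕ) {j : ℕ} (hj : 2 * N * D.K < j) :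
    D.sumMass V N k j = 0 := by
  induction k generalizing j with
  | zero => simp [sumMass, hj.ne']
  | succ k ih =>
    rw [sumMass]
    exact Finset.sum_eq_zero fun a _ => by rw [ih (by omega), mul_zero]

/-! ### Range and bit length of the intermediate quantities -/

section Valid
variable {u : ℕ} (hD : D.IsValid u)
include hD

theorem IsValid.sqSum_fits (n : ℕ) : FitsBits (8 * u + 5) (D.sqSum n) := by
  have h1 := (hD.x_fits n).sub (hD.y_fits (n / D.L))
  have h2 := (hD.x_fits n).sub (hD.z_fits (n / D.L))
  exact ((h1.mul h1).add (h2.mul h2)).mono (by omega)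

theorem IsValid.gap_fits (n : ℕ) : FitsBits (8 * u + 5) (D.gap n) := by
  have h1 := (hD.x_fits n).sub (hD.y_fits (n / D.L))
  have h2 := (hD.x_fits n).sub (hD.z_fits (n / D.L))
  exact ((h1.mul h1).sub (h2.mul h2)).mono (by omega)

theorem IsValid.meanCost_fits (n : ℕ) : FitsBits (n * (5 * u + 3)) (D.meanCost n) := by
  refine FitsBits.sum (a := 5 * u + 2) (fun i => ?_) n
  have h2 := (hD.x_fits i).sub (hD.z_fits (i / D.L))
  exact ((hD.p_fits i).mul (h2.mul h2)).mono (by omega)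

theorem IsValid.binMass_fits (V : ℚ) (N k m a : ℕ) :
    FitsBits (m * (u + 1)) (D.binMass V N k m a) := by
  refine FitsBits.sum (a := u) (fun l => ?_) m
  split_ifs
  exacts [hD.p_fits _, FitsBits.zero]

theorem IsValid.binMass_nonneg (V : ℚ) (N k m a : ℕ) : 0 ≤ D.binMass V N k m a := by
  refine Finset.sum_nonneg fun l _ => ?_
  split_ifs
  exacts [hD.p_nonneg _, le_rfl]

/-- After exchanging the sums, each atom falls into at most one of the first `m` bins. The bound for
every `m` is used for the partial sums of the convolution. -/
theorem IsValid.sum_binMass_le (V : ℚ) (N : ℕ) {k : ℕ} (hk : k < D.K) (m : ℕ) :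
    ∑ a ∈ Finset.range m, D.binMass V N k D.L a ≤ 1 := by
  unfold binMass
  rw [Finset.sum_comm, ← hD.p_sum k hk]
  refine Finset.sum_le_sum fun l _ => ?_
  rw [Finset.sum_ite_eq']
  split_ifs
  exacts [le_rfl, hD.p_nonneg _]

theorem IsValid.sumMass_nonneg (V : ℚ) (N k j : ℕ) : 0 ≤ D.sumMass V N k j := by
  induction k generalizing j with
  | zero =>
    rw [sumMass]
    split_ifs <;> norm_num
  | succ k ih =>
    rw [sumMass]
    exact Finset.sum_nonneg fun a _ => mul_nonneg (hD.binMass_nonneg _ _ _ _ _) (ih _)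

theorem IsValid.sumMass_le_one (V : ℚ) (N : ℕ) {k : ℕ} (hk : k ≤ D.K) (j : ℕ) :
    D.sumMass V N k j ≤ 1 := by
  induction k generalizing j with
  | zero =>
    rw [sumMass]
    split_ifs <;> norm_num
  | succ k ih =>
    rw [sumMass]
    refine le_trans (Finset.sum_le_sum fun a _ => ?_) (hD.sum_binMass_le V N hk (2 * N + 1))
    exact mul_le_of_le_one_right (hD.binMass_nonneg _ _ _ _ _) (ih (by omega) _)

/-- Every partial sum is written to a register, so all of them, not only the complete one, need a
bound. -/
theorem IsValid.convolution_bounds (V : ℚ) (N : ℕ) {k : ℕ} (hk : k < D.K) (j m : ℕ) :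
    |∑ a ∈ Finset.range m, D.binMass V N k D.L a * D.sumMass V N k (j + a)| ≤ 1 := by
  rw [abs_of_nonneg (Finset.sum_nonneg fun a _ =>
    mul_nonneg (hD.binMass_nonneg _ _ _ _ _) (hD.sumMass_nonneg _ _ _ _))]
  refine le_trans (Finset.sum_le_sum fun a _ => ?_) (hD.sum_binMass_le V N hk m)
  exact mul_le_of_le_one_right (hD.binMass_nonneg _ _ _ _ _) (hD.sumMass_le_one _ _ hk.le _)

/-- The crude bound by the number of summands is enough, since only its logarithm enters the bit
length. -/
theorem IsValid.cumMass_abs_le (V : ℚ) (N j : ℕ) : |D.cumMass V N j| ≤ j := by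
  unfold cumMass
  rw [abs_of_nonneg (Finset.sum_nonneg fun a _ => hD.sumMass_nonneg _ _ _ _)]
  calc _ ≤ ∑ s ∈ Finset.range j, (1 : ℚ) :=
        Finset.sum_le_sum fun s _ => hD.sumMass_le_one _ _ le_rfl _
    _ = j := by simp

theorem IsValid.cumMass_nonneg (V : ℚ) (N j : ℕ) : 0 ≤ D.cumMass V N j :=
  Finset.sum_nonneg fun _ _ => hD.sumMass_nonneg _ _ _ _

theorem IsValid.truncSum_abs_le (V : ℚ) (N j : ℕ) : |D.truncSum V N j| ≤ j := by
  unfold truncSum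
  rw [abs_of_nonneg (Finset.sum_nonneg fun a _ => le_min hD.t_nonneg (hD.cumMass_nonneg _ _ _))]
  calc _ ≤ ∑ s ∈ Finset.range j, (1 : ℚ) :=
        Finset.sum_le_sum fun s _ => (min_le_left _ _).trans hD.t_le
    _ = j := by simp

end Valid

variable (D) in
/-- A common denominator of the probabilities of the first `k` marginals. -/
def commonDen (k : ℕ) : ℕ := ∏ n ∈ Finset.range (k * D.L), (D.p n).den

theorem commonDen_pos (k : ℕ) : 0 < D.commonDen k :=
  Finset.prod_pos fun n _ => (D.p n).den_pos

theorem IsValid.commonDen_le {u : ℕ} (hD : D.IsValid u) (k : ℕ) :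
    D.commonDen k ≤ 2 ^ (u * (k * D.L)) := by
  calc D.commonDen k ≤ ∏ n ∈ Finset.range (k * D.L), 2 ^ u :=
        Finset.prod_le_prod' fun n _ => (hD.p_fits n).den_le
    _ = _ := by rw [Finset.prod_const, Finset.card_range, ← pow_mul]

theorem commonDen_succ (k : ℕ) :
    D.commonDen (k + 1) = (∏ l ∈ Finset.range D.L, (D.p (k * D.L + l)).den) * D.commonDen k := by
  unfold commonDen
  rw [Nat.succ_mul, Finset.prod_range_add, mul_comm]

theorem binMass_integral (V : ℚ) (N k a : ℕ) :
    IsIntegralMul (∏ l ∈ Finset.range D.L, (D.p (k * D.L + l)).den) (D.binMass V N k D.L a) := by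
  refine IsIntegralMul.sum _ fun l hl => ?_
  split_ifs
  · exact (IsIntegralMul.den _).of_dvd
      (Finset.dvd_prod_of_mem (fun l => (D.p (k * D.L + l)).den) hl)
  · exact .zero

/-- Every term of the convolution contains one factor from each marginal. Denominators thus multiply
across marginals, while the number of terms plays no role. -/
theorem sumMass_integral (V : ℚ) (N k j : ℕ) :
    IsIntegralMul (D.commonDen k) (D.sumMass V N k j) := by
  induction k generalizing j with
  | zero =>
    rw [sumMass]
    split_ifs
    · exact ⟨D.commonDen 0, by simp⟩
    · exact .zero
  | succ k ih =>
    rw [sumMass, commonDen_succ]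
    exact .sum _ fun a _ => (binMass_integral V N k a).mul (ih _)

theorem convolution_integral (V : ℚ) (N k j m : ℕ) :
    IsIntegralMul (D.commonDen (k + 1))
      (∑ a ∈ Finset.range m, D.binMass V N k D.L a * D.sumMass V N k (j + a)) := by
  rw [commonDen_succ]
  exact .sum _ fun a _ => (binMass_integral V N k a).mul (sumMass_integral V N k _)

theorem cumMass_integral (V : ℚ) (N j : ℕ) :
    IsIntegralMul (D.commonDen D.K) (D.cumMass V N j) :=
  .sum _ fun _ _ => sumMass_integral V N D.K _

/-- Each minimum is either `t` or a cumulative mass, so the denominator of `t` is the only new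
factor. -/
theorem truncSum_integral (V : ℚ) (N j : ℕ) :
    IsIntegralMul (D.t.den * D.commonDen D.K) (D.truncSum V N j) := by
  refine .sum _ fun s _ => ?_
  rcases min_choice D.t (D.cumMass V N (s + 1)) with h | h <;> rw [h]
  · exact (IsIntegralMul.den _).of_dvd (dvd_mul_right _ _)
  · exact (cumMass_integral V N _).of_dvd (dvd_mul_left _ _)

/-- `β` bounds all sizes that occur in the computation with `2 ^ m` grid points per unit. -/
structure SizeBound (u m β : ℕ) (D : FlatInstance) : Prop where
  data : D.K * D.L * (u + 1) ≤ β
  K_le : D.K ≤ β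
  L_le : D.L ≤ β
  u_le : u ≤ β
  m_le : m ≤ β
  pos : 1 ≤ β

section Fits
variable {u m β : ℕ} (hD : D.IsValid u) (hβ : D.SizeBound u m β)
include hD hβ

theorem IsValid.meanCost_fits' {n : ℕ} (hn : n ≤ D.K * D.L) : FitsBits (5 * β) (D.meanCost n) := by
  refine (hD.meanCost_fits n).mono ?_
  calc n * (5 * u + 3) ≤ D.K * D.L * (5 * (u + 1)) := Nat.mul_le_mul hn (by omega)
    _ = 5 * (D.K * D.L * (u + 1)) := by ring
    _ ≤ 5 * β := Nat.mul_le_mul_left _ hβ.data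

theorem IsValid.binMass_fits' (V : ℚ) (N k a : ℕ) {n : ℕ} (hn : n ≤ D.L) :
    FitsBits β (D.binMass V N k n a) := by
  refine (hD.binMass_fits V N k n a).mono (le_trans ?_ hβ.data)
  exact Nat.mul_le_mul (hn.trans (Nat.le_mul_of_pos_left _ hD.K_pos)) le_rfl

theorem IsValid.commonDen_le' {k : ℕ} (hk : k ≤ D.K) : D.commonDen k ≤ 2 ^ β := by
  refine (hD.commonDen_le k).trans (Nat.pow_le_pow_right (by norm_num) (le_trans ?_ hβ.data))
  calc u * (k * D.L) ≤ (u + 1) * (D.K * D.L) :=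
        Nat.mul_le_mul (by omega) (Nat.mul_le_mul_right _ hk)
    _ = _ := mul_comm _ _

theorem IsValid.convolution_fits (V : ℚ) (N : ℕ) {k : ℕ} (hk : k < D.K) (j n : ℕ) :
    FitsBits β (∑ a ∈ Finset.range n, D.binMass V N k D.L a * D.sumMass V N k (j + a)) := by
  obtain ⟨z, hz⟩ := convolution_integral (D := D) V N k j n
  exact FitsBits.of_mul_eq_intCast (b := 0) (commonDen_pos _) (hD.commonDen_le' hβ hk) hz
    (by simpa using hD.convolution_bounds V N hk j n)

theorem IsValid.sumMass_fits (V : ℚ) (N : ℕ) {k : ℕ} (hk : k ≤ D.K) (j : ℕ) :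
    FitsBits β (D.sumMass V N k j) := by
  obtain ⟨z, hz⟩ := sumMass_integral (D := D) V N k j
  refine FitsBits.of_mul_eq_intCast (b := 0) (commonDen_pos _) (hD.commonDen_le' hβ hk) hz ?_
  rw [abs_of_nonneg (hD.sumMass_nonneg _ _ _ _)]
  simpa using hD.sumMass_le_one V N hk j

-- The factors 2, `2 ^ m` and `K` are at most `2 ^ β` each; the fourth `β` absorbs the summand 1.
omit hD in
theorem total_le {j : ℕ} (hj : j ≤ 2 * 2 ^ m * D.K + 1) : j ≤ 2 ^ (4 * β) := by
  have h1 : 2 ^ m ≤ 2 ^ β := Nat.pow_le_pow_right (by norm_num) hβ.m_le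
  have h2 : D.K ≤ 2 ^ β := hβ.K_le.trans Nat.lt_two_pow_self.le
  have h3 : 2 ≤ 2 ^ β := by simpa using Nat.pow_le_pow_right (by norm_num : 0 < 2) hβ.pos
  calc j ≤ 2 * 2 ^ m * D.K + 1 := hj
    _ ≤ 2 ^ β * 2 ^ β * 2 ^ β + 2 ^ β * 2 ^ β * 2 ^ β := by
      refine Nat.add_le_add (Nat.mul_le_mul (Nat.mul_le_mul h3 h1) h2) ?_
      exact Nat.one_le_iff_ne_zero.2 (by positivity)
    _ = 2 * (2 ^ β * 2 ^ β * 2 ^ β) := by ring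
    _ ≤ 2 ^ β * (2 ^ β * 2 ^ β * 2 ^ β) := Nat.mul_le_mul_right _ h3
    _ = _ := by ring

theorem IsValid.cumMass_fits (V : ℚ) (N : ℕ) {j : ℕ} (hj : j ≤ 2 * 2 ^ m * D.K + 1) :
    FitsBits (5 * β) (D.cumMass V N j) := by
  obtain ⟨z, hz⟩ := cumMass_integral (D := D) V N j
  refine (FitsBits.of_mul_eq_intCast (b := 4 * β) (commonDen_pos _) (hD.commonDen_le' hβ le_rfl)
    hz ?_).mono (by omega)
  exact (hD.cumMass_abs_le V N j).trans (by exact_mod_cast total_le hβ hj)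

theorem IsValid.truncSum_fits (V : ℚ) (N : ℕ) {j : ℕ} (hj : j ≤ 2 * 2 ^ m * D.K + 1) :
    FitsBits (6 * β) (D.truncSum V N j) := by
  obtain ⟨z, hz⟩ := truncSum_integral (D := D) V N j
  have hd : D.t.den * D.commonDen D.K ≤ 2 ^ (2 * β) := by
    calc _ ≤ 2 ^ β * 2 ^ β := Nat.mul_le_mul (hD.t_fits.mono hβ.u_le).den_le
            (hD.commonDen_le' hβ le_rfl)
      _ = _ := by ring
  refine (FitsBits.of_mul_eq_intCast (b := 4 * β) (Nat.mul_pos D.t.den_pos (commonDen_pos _)) hd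
    hz ?_).mono (by omega)
  exact (hD.truncSum_abs_le V N j).trans (by exact_mod_cast total_le hβ hj)

theorem IsMaxSqSum.fits {n : ℕ} {V : ℚ} (hV : D.IsMaxSqSum n V) : FitsBits (13 * β) V := by
  have h1 := hβ.u_le
  have h2 := hβ.pos
  rcases hV.eq with rfl | ⟨i, -, rfl⟩
  · exact .zero
  · exact (hD.sqSum_fits i).mono (by omega)

end Fits

end FlatInstance

namespace RatRam

open FlatInstance

/-! ### The program -/

/-- `x - y₁` for the atom whose index is in register `11`. -/
def devY : Term := .cell 1 (.reg 11) - .cell 2 (.reg 11 / .reg 1)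

/-- `x - y₂` for the atom whose index is in register `11`. -/
def devZ : Term := .cell 1 (.reg 11) - .cell 3 (.reg 11 / .reg 1)

/-- One pass over the atoms: register `5` becomes the maximum of `sqSum`, register `6` the mean
squared distance to `y₂`. -/
def scanProgram : Program :=
  .seq (.assign 12 (.reg 0 * .reg 1)) <|
  countLoop 11 12 <|
    .seq (.branch (.reg 5) (devY * devY + devZ * devZ) (.assign 5 (devY * devY + devZ * devZ)) .skip)
      (.assign 6 (.reg 6 + .cell 0 (.reg 11) * (devZ * devZ)))

/-- Doubles the number of grid points in register `7` until the error bound in register `8` is at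
most `ε`. -/
def refineProgram : Program :=
  .seq (.assign 7 (.const 1)) <|
  .loop (.reg 3) (.reg 8) <|
    .seq (.assign 7 (.reg 7 * .const 2)) (.assign 8 (.reg 8 / .const 2))

/-- Computes the loop bounds and the initial distribution. -/
def setupProgram : Program :=
  .seq (.assign 8 (.const 2 * .reg 7 * .reg 0)) <|
  .seq (.assign 9 (.const 2 * .reg 7 + .const 1)) <|
  .seq (.assign 10 (.reg 8 + .const 1)) <|
  .seq (.store 5 (.reg 8) (.const 1)) <|
  .assign 11 (.const 0)

/-- Clears the bins. -/
def clearProgram : Program :=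
  .seq (.assign 13 (.const 0)) <|
  countLoop 13 9 (.store 4 (.reg 13) (.const 0))

/-- The index of the current atom. -/
def atomIndex : Term := .reg 11 * .reg 1 + .reg 12

/-- `x - y₁` for the current atom. -/
def atomDevY : Term := .cell 1 atomIndex - .cell 2 (.reg 11)

/-- `x - y₂` for the current atom. -/
def atomDevZ : Term := .cell 1 atomIndex - .cell 3 (.reg 11)

/-- The bin of the current atom (before rounding). -/
def atomBin : Term :=
  (atomDevY * atomDevY - atomDevZ * atomDevZ) * .reg 7 / .reg 5 + .reg 7

/-- Distributes the atoms of the marginal in register `11` to the bins. -/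
def binProgram : Program :=
  .seq (.assign 12 (.const 0)) <|
  countLoop 12 1 (.store 4 atomBin (.cell 4 atomBin + .cell 0 atomIndex))

/-- Convolution at one point. -/
def dotProgram : Program :=
  .seq (.assign 15 (.const 0)) <|
  .seq (.assign 14 (.const 0)) <|
  countLoop 14 9 (.assign 15 (.reg 15 + .cell 4 (.reg 14) * .cell 5 (.reg 13 + .reg 14)))

/-- Convolution of the distribution in array `5` with the bins in array `4`. -/
def convolveProgram : Program :=
  .seq (.assign 13 (.const 0)) <|
  countLoop 13 10 (.seq dotProgram (.store 5 (.reg 13) (.reg 15)))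

/-- The distribution of the sum of all marginals. -/
def sumProgram : Program :=
  countLoop 11 0 (.seq clearProgram (.seq binProgram convolveProgram))

/-- Sums up the truncated cumulative distribution and computes the result. -/
def evalProgram : Program :=
  .seq (.assign 16 (.const 0)) <|
  .seq (.assign 15 (.const 0)) <|
  .seq (.assign 13 (.const 0)) <|
  .seq (countLoop 13 8 <|
    .seq (.assign 16 (.reg 16 + .cell 5 (.reg 8 - .reg 13))) <|
    .branch (.reg 2) (.reg 16) (.assign 15 (.reg 15 + .reg 2)) (.assign 15 (.reg 15 + .reg 16)))
  (.assign 4 (.reg 6 + .reg 5 / .reg 7 * (.reg 0 * .reg 7 * .reg 2 - .reg 15)))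

/-- The program that approximates the optimal transport distance. -/
def transportProgram : Program :=
  .seq scanProgram <|
  .seq (.assign 8 (.reg 0 * .reg 5)) <|
  .branch (.reg 3) (.reg 8)
    (.seq refineProgram (.seq setupProgram (.seq sumProgram evalProgram))) (.assign 4 (.const 0))

/-! ### Its analysis -/

variable {D : FlatInstance} {u m β : ℕ} {V : ℚ}

/-- The memory holds the instance `D`. -/
structure Holds (D : FlatInstance) (s : State) : Prop where
  K : s.reg 0 = D.K
  L : s.reg 1 = D.L
  t : s.reg 2 = D.t
  ε : s.reg 3 = D.ε
  p : s.arr 0 = D.p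
  x : s.arr 1 = D.x
  y : s.arr 2 = D.y
  z : s.arr 3 = D.z

theorem Holds.setReg {s : State} (h : Holds D s) {r : ℕ} (hr : 4 ≤ r) (q : ℚ) :
    Holds D (s.setReg r q) := by
  obtain ⟨h0, h1, h2, h3, h4, h5, h6, h7⟩ := h
  constructor <;> first | assumption | (rw [State.reg_setReg, if_neg (by omega)]; assumption)

theorem Holds.setCell {s : State} (h : Holds D s) {a : ℕ} (ha : 4 ≤ a) (n : ℕ) (q : ℚ) :
    Holds D (s.setCell a n q) := by
  obtain ⟨h0, h1, h2, h3, h4, h5, h6, h7⟩ := h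
  constructor <;> first | assumption | (rw [State.arr_setCell_of_ne _ (by omega)]; assumption)

/-- The scan finds the coordinate of atom `n` by the rational division of `n` by `L`; rounding of
addresses turns this into division of natural numbers. -/
theorem floor_natCast_div (n l : ℕ) : ⌊(n : ℚ) / l⌋₊ = n / l := Nat.floor_div_eq_div n l

section Main
variable (hD : D.IsValid u) (hβ : D.SizeBound u m β)
include hD hβ

theorem scanProgram_achieves {s : State} (hs : Holds D s) (h5 : s.reg 5 = 0) (h6 : s.reg 6 = 0)
    (h11 : s.reg 11 = 0)
    (ha : s.arr 5 = 0) :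
    Achieves (100 * β) scanProgram s (D.K * D.L * 58 + 3) fun s' =>
      Holds D s' ∧ D.IsMaxSqSum (D.K * D.L) (s'.reg 5) ∧ s'.reg 6 = D.meanCost (D.K * D.L) ∧
        s'.arr 5 = 0 := by
  have hu := hβ.u_le
  have h1β := hβ.pos
  have hKL : D.K * D.L ≤ 2 ^ β :=
    ((Nat.le_mul_of_pos_right _ (by omega)).trans hβ.data).trans Nat.lt_two_pow_self.le
  have hfKL : FitsBits (100 * β) ((D.K : ℚ) * D.L) := by
    exact_mod_cast (FitsBits.natCast hKL).mono (by omega)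
  refine ((Achieves.assign (Post := fun s' => Holds D s' ∧ s'.reg 5 = 0 ∧ s'.reg 6 = 0 ∧
    s'.reg 11 = 0 ∧ s'.reg 12 = (D.K * D.L : ℕ) ∧ s'.arr 5 = 0) ?_ ?_).seq (n' := D.K * D.L * 58 + 1) ?_).mono
    ?_ fun _ h => h
  · simpa [hs.K, hs.L] using hfKL
  · refine ⟨hs.setReg (by norm_num) _, ?_⟩
    simp [h5, h6, h11, hs.K, hs.L, ha]
  swap
  · simp
    omega
  rintro s ⟨hs, h5, h6, h11, h12, ha⟩
  refine (Achieves.countLoop (n := 55) (J := D.K * D.L) (fun j s => Holds D s ∧ s.reg 11 = j ∧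
    s.reg 12 = (D.K * D.L : ℕ) ∧ D.IsMaxSqSum j (s.reg 5) ∧ s.reg 6 = D.meanCost j ∧
    s.arr 5 = 0)
    (fun j s h => ⟨h.2.1, h.2.2.1⟩) (hKL.trans (Nat.pow_le_pow_right (by norm_num) (by omega))) ?_
    ⟨hs, by simpa using h11, h12, ⟨by simp, h5.ge, Or.inl h5⟩, by simp [h6, meanCost], ha⟩).mono
    le_rfl fun _ h => ⟨h.1, h.2.2.2⟩
  rintro j hj s ⟨hs, h11, h12, hV, h6, ha⟩
  have hy : devY.eval s = D.x j - D.y (j / D.L) := by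
    simp [devY, h11, hs.x, hs.y, hs.L, floor_natCast_div]
  have hz : devZ.eval s = D.x j - D.z (j / D.L) := by
    simp [devZ, h11, hs.x, hs.z, hs.L, floor_natCast_div]
  have fdiv : FitsBits (100 * β) ((j : ℚ) / D.L) :=
    ((FitsBits.natCast (hj.le.trans hKL)).div
      (FitsBits.natCast (hβ.L_le.trans Nat.lt_two_pow_self.le))).mono (by omega)
  have fy := (hD.x_fits j).sub (hD.y_fits (j / D.L))
  have fz := (hD.x_fits j).sub (hD.z_fits (j / D.L))
  have cy : ∀ q ∈ devY.computed s, FitsBits (100 * β) q := by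
    simpa [devY, h11, hs.x, hs.y, hs.L, floor_natCast_div] using ⟨fdiv, fy.mono (by omega)⟩
  have cz : ∀ q ∈ devZ.computed s, FitsBits (100 * β) q := by
    simpa [devZ, h11, hs.x, hs.z, hs.L, floor_natCast_div] using ⟨fdiv, fz.mono (by omega)⟩
  have cv : ∀ q ∈ (devY * devY + devZ * devZ).computed s, FitsBits (100 * β) q := by
    simp only [Term.computed_add, Term.computed_mul, List.mem_append, List.mem_singleton, hy, hz,
      Term.eval_mul]
    rintro q ((((h | h) | rfl) | (h | h) | rfl) | rfl)
    exacts [cy q h, cy q h, (fy.mul fy).mono (by omega), cz q h, cz q h, (fz.mul fz).mono (by omega),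
      (hD.sqSum_fits j).mono (by omega)]
  have hv : (devY * devY + devZ * devZ).eval s = D.sqSum j := by
    simp [hy, hz, sqSum]
  refine (Achieves.seq (n := 40) (n' := 15) (Mid := fun s' => Holds D s' ∧ s'.reg 11 = j ∧
    s'.reg 12 = (D.K * D.L : ℕ) ∧ D.IsMaxSqSum (j + 1) (s'.reg 5) ∧ s'.reg 6 = D.meanCost j ∧
    s'.arr 5 = 0) ?_ ?_)
  · refine (Achieves.branch (n := 20) ?_ ?_ ?_).mono ?_ fun _ h => h
    · simpa using cv
    · intro hlt
      rw [hv] at hlt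
      refine (Achieves.assign ?_ ?_).mono ?_ fun _ h => h
      · simp only [List.mem_append, List.mem_singleton, hv]
        rintro q (h | rfl)
        exacts [cv q h, (hD.sqSum_fits j).mono (by omega)]
      · refine ⟨hs.setReg (by norm_num) _, by simp [h11], by simp [h12], ?_, by simp [h6], by simp [ha]⟩
        rw [hv]
        simp only [State.reg_setReg, if_true]
        simp only [Term.eval_reg] at hlt
        exact hV.succ_of_lt hlt
      · simp [devY, devZ]
    · intro hlt
      rw [hv] at hlt
      refine (Achieves.skip ⟨hs, h11, h12, hV.succ_of_le (not_lt.1 hlt), h6, ha⟩).mono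
        (Nat.zero_le _) fun _ h => h
    · simp [devY, devZ]
  · rintro s' ⟨hs', h11', h12', hV', h6', ha'⟩
    have hz : devZ.eval s' = D.x j - D.z (j / D.L) := by
      simp [devZ, h11', hs'.x, hs'.z, hs'.L, floor_natCast_div]
    have cz : ∀ q ∈ devZ.computed s', FitsBits (100 * β) q := by
      simpa [devZ, h11', hs'.x, hs'.z, hs'.L, floor_natCast_div] using ⟨fdiv, fz.mono (by omega)⟩
    have hm : s'.reg 6 + (s'.arr 0 j * (devZ * devZ).eval s') = D.meanCost (j + 1) := by
      rw [h6', hs'.p, Term.eval_mul, hz, meanCost, meanCost, Finset.sum_range_succ]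
    have fm : FitsBits (100 * β) (D.meanCost (j + 1)) :=
      (hD.meanCost_fits' hβ (by omega)).mono (by omega)
    refine (Achieves.assign ?_ ?_).mono ?_ fun _ h => h
    · simp only [Term.computed_add, Term.computed_mul, Term.computed_reg, Term.computed_cell,
        List.mem_append, List.mem_singleton, List.not_mem_nil, false_or, Term.eval_mul,
        Term.eval_add, Term.eval_reg, Term.eval_cell, h11', Nat.floor_natCast] at hm ⊢
      rw [hm]
      rintro q (((((h | h) | rfl) | rfl) | rfl) | rfl)
      · exact cz q h
      · exact cz q h
      · rw [hz]
        exact (fz.mul fz).mono (by omega)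
      · rw [hz, hs'.p]
        exact ((hD.p_fits j).mul (fz.mul fz)).mono (by omega)
      · exact fm
      · exact fm
    · refine ⟨by simp [h11'], (hs'.setReg (by norm_num) _).setReg (by norm_num) _, by simp,
        by simp [h12'], by simpa using hV', ?_, by simp [ha']⟩
      simpa [h11'] using hm
    · simp [devZ]

end Main

end RatRam

/-! ### Choice of the resolution and binning of the atoms -/

namespace RatRam

open FlatInstance

variable {D : FlatInstance} {u m β : ℕ} {V : ℚ}

/-- The memory during the computation of the distribution of the sum, with `N` grid points per
unit. -/
structure Ready (D : FlatInstance) (V : ℚ) (N : ℕ) (s : State) : Prop extends Holds D s where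
  scale : s.reg 5 = V
  mean : s.reg 6 = D.meanCost (D.K * D.L)
  resolution : s.reg 7 = N
  top : s.reg 8 = (2 * N * D.K : ℕ)
  bins : s.reg 9 = (2 * N + 1 : ℕ)
  cells : s.reg 10 = (2 * N * D.K + 1 : ℕ)

theorem Ready.setReg {N : ℕ} {s : State} (h : Ready D V N s) {r : ℕ} (hr : 11 ≤ r) (q : ℚ) :
    Ready D V N (s.setReg r q) := by
  obtain ⟨h0, h1, h2, h3, h4, h5, h6⟩ := h
  refine ⟨h0.setReg (by omega) q, ?_, ?_, ?_, ?_, ?_, ?_⟩ <;>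
    (rw [State.reg_setReg, if_neg (by omega)]; assumption)

theorem Ready.setCell {N : ℕ} {s : State} (h : Ready D V N s) {a : ℕ} (ha : 4 ≤ a) (n : ℕ) (q : ℚ) :
    Ready D V N (s.setCell a n q) := by
  obtain ⟨h0, h1, h2, h3, h4, h5, h6⟩ := h
  exact ⟨h0.setCell ha n q, h1, h2, h3, h4, h5, h6⟩

section Main
variable (hD : D.IsValid u) (hβ : D.SizeBound u m β)
include hD hβ

-- Register 8 holds the error bound `K * V / 2 ^ j` after `j` doublings, so the loop stops at the
-- first exponent whose error is at most `ε`, which the hypotheses say is `m`.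
omit hD in
theorem refineProgram_achieves (hV : FitsBits (13 * β) V) {s : State} (hs : Holds D s)
    (h5 : s.reg 5 = V) (h6 : s.reg 6 = D.meanCost (D.K * D.L)) (h8 : s.reg 8 = D.K * V)
    (hm : ∀ j < m, D.ε < D.K * V / 2 ^ j) (hm' : D.K * V / 2 ^ m ≤ D.ε)
    (h5' : s.arr 5 = 0) :
    Achieves (100 * β) refineProgram s (m * 5 + 2) fun s' =>
      Holds D s' ∧ s'.reg 5 = V ∧ s'.reg 6 = D.meanCost (D.K * D.L) ∧ s'.reg 7 = (2 ^ m : ℕ) ∧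
        s'.arr 5 = 0 := by
  have hmβ := hβ.m_le
  have h1β := hβ.pos
  refine ((Achieves.assign (Post := fun s' => Holds D s' ∧ s'.reg 5 = V ∧
    s'.reg 6 = D.meanCost (D.K * D.L) ∧ s'.reg 8 = D.K * V ∧ s'.reg 7 = 1 ∧ s'.arr 5 = 0)
    ?_ ?_).seq (n' := m * 5 + 1) ?_).mono ?_ fun _ h => h
  · simpa using FitsBits.one
  · exact ⟨hs.setReg (by norm_num) _, by simp [h5], by simp [h6], by simp [h8], by simp, by simp [h5']⟩
  swap
  · simp
    omega
  rintro s ⟨hs, h5, h6, h8, h7, h5'⟩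
  refine (Achieves.loop (n := 4) (J := m) (fun j s => Holds D s ∧ s.reg 5 = V ∧
    s.reg 6 = D.meanCost (D.K * D.L) ∧ s.reg 7 = (2 ^ j : ℕ) ∧ s.reg 8 = D.K * V / 2 ^ j ∧
    s.arr 5 = 0) ?_ ?_ ?_ ⟨hs, h5, h6, by simp [h7], by simp [h8], h5'⟩).mono le_rfl
    fun _ h => ⟨h.1, h.2.1, h.2.2.1, h.2.2.2.1, h.2.2.2.2.2⟩
  · rintro j hj s ⟨hs, -, -, -, h8, -⟩
    rw [hs.ε, h8]
    exact hm j hj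
  · rintro s ⟨hs, -, -, -, h8, -⟩
    rw [hs.ε, h8]
    exact hm'.not_gt
  · rintro j hj s ⟨hs, h5, h6, h7, h8, h5'⟩
    have hpow : ∀ i ≤ m, FitsBits β ((2 : ℚ) ^ i) := fun i hi => by
      exact_mod_cast FitsBits.natCast (b := β) (n := 2 ^ i)
        (Nat.pow_le_pow_right (by norm_num) (hi.trans hmβ))
    have f7 : FitsBits (100 * β) ((2 : ℚ) ^ j * 2) := by
      rw [← pow_succ]
      exact (hpow _ hj).mono (by omega)
    have e8 : (D.K : ℚ) * V / 2 ^ j / 2 = D.K * V / 2 ^ (j + 1) := by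
      rw [div_div, pow_succ]
    have f8 : FitsBits (100 * β) ((D.K : ℚ) * V / 2 ^ j / 2) := by
      rw [e8]
      exact (((FitsBits.natCast (hβ.K_le.trans Nat.lt_two_pow_self.le)).mul hV).div
        (hpow _ hj)).mono (by omega)
    refine (Achieves.assign (Post := fun s' => Holds D s' ∧ s'.reg 5 = V ∧
      s'.reg 6 = D.meanCost (D.K * D.L) ∧ s'.reg 7 = (2 ^ (j + 1) : ℕ) ∧
      s'.reg 8 = D.K * V / 2 ^ j ∧ s'.arr 5 = 0) ?_ ?_).seq (n' := 2) ?_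
    · simpa [h7] using f7
    · exact ⟨hs.setReg (by norm_num) _, by simp [h5], by simp [h6], by simp [h7, pow_succ],
        by simp [h8], by simp [h5']⟩
    · rintro s ⟨hs, h5, h6, h7, h8, h5'⟩
      refine Achieves.assign ?_ ?_
      · simpa [h8] using f8
      · exact ⟨hs.setReg (by norm_num) _, by simp [h5], by simp [h6], by simp [h7],
          by simp [h8, e8], by simp [h5']⟩

omit hD in
theorem fits_of_le_total {n : ℕ} (hn : n ≤ 2 * 2 ^ m * D.K + 1) : FitsBits (4 * β) (n : ℚ) :=
  .natCast (total_le hβ hn)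

omit hβ in
theorem two_pow_le_total : 2 * 2 ^ m + 1 ≤ 2 * 2 ^ m * D.K + 1 :=
  Nat.succ_le_succ (Nat.le_mul_of_pos_right _ hD.K_pos)

/-- The initial law is a point mass, for which a single cell is written; this is why the vanishing
of array 5 has been carried along from the input memory. -/
theorem setupProgram_achieves {s : State} (hs : Holds D s) (h5 : s.reg 5 = V)
    (h6 : s.reg 6 = D.meanCost (D.K * D.L)) (h7 : s.reg 7 = (2 ^ m : ℕ)) (h5' : s.arr 5 = 0) :
    Achieves (100 * β) setupProgram s 10 fun s' =>
      Ready D V (2 ^ m) s' ∧ s'.arr 5 = D.sumMass V (2 ^ m) 0 ∧ s'.reg 11 = 0 := by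
  have h1β := hβ.pos
  have htot := two_pow_le_total (m := m) hD
  have f1 : FitsBits (100 * β) ((2 * 2 ^ m : ℕ) : ℚ) :=
    (fits_of_le_total hβ (by omega)).mono (by omega)
  have f2 : FitsBits (100 * β) ((2 * 2 ^ m * D.K : ℕ) : ℚ) :=
    (fits_of_le_total hβ (by omega)).mono (by omega)
  have f3 : FitsBits (100 * β) ((2 * 2 ^ m + 1 : ℕ) : ℚ) :=
    (fits_of_le_total hβ htot).mono (by omega)
  have f4 : FitsBits (100 * β) ((2 * 2 ^ m * D.K + 1 : ℕ) : ℚ) :=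
    (fits_of_le_total hβ (by omega)).mono (by omega)
  push_cast at f1 f2 f3 f4
  refine ((Achieves.assign (Post := fun s' => Holds D s' ∧ s'.reg 5 = V ∧
    s'.reg 6 = D.meanCost (D.K * D.L) ∧ s'.reg 7 = (2 ^ m : ℕ) ∧
    s'.reg 8 = (2 * 2 ^ m * D.K : ℕ) ∧ s'.arr 5 = 0) ?_ ?_).seq (n' := 7) ?_)
  · simpa [h7, hs.K] using ⟨f1, f2⟩
  · exact ⟨hs.setReg (by norm_num) _, by simp [h5], by simp [h6], by simp [h7], by simp [h7, hs.K],
      by simp [h5']⟩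
  rintro s ⟨hs, h5, h6, h7, h8, h5'⟩
  refine ((Achieves.assign (Post := fun s' => Holds D s' ∧ s'.reg 5 = V ∧
    s'.reg 6 = D.meanCost (D.K * D.L) ∧ s'.reg 7 = (2 ^ m : ℕ) ∧
    s'.reg 8 = (2 * 2 ^ m * D.K : ℕ) ∧ s'.reg 9 = (2 * 2 ^ m + 1 : ℕ) ∧ s'.arr 5 = 0)
    ?_ ?_).seq (n' := 4) ?_)
  · simpa [h7, hs.K] using ⟨f1, f3⟩
  · exact ⟨hs.setReg (by norm_num) _, by simp [h5], by simp [h6], by simp [h7], by simp [h8],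
      by simp [h7], by simp [h5']⟩
  rintro s ⟨hs, h5, h6, h7, h8, h9, h5'⟩
  refine ((Achieves.assign (Post := fun s' => Ready D V (2 ^ m) s' ∧ s'.arr 5 = 0)
    ?_ ?_).seq (n' := 2) ?_)
  · simpa [h8] using f4
  · exact ⟨⟨hs.setReg (by norm_num) _, by simp [h5], by simp [h6], by simp [h7], by simp [h8],
      by simp [h9], by simp [h8]⟩, by simp [h5']⟩
  rintro s ⟨hs, h5'⟩
  refine ((Achieves.store (Post := fun s' => Ready D V (2 ^ m) s' ∧
    s'.arr 5 = D.sumMass V (2 ^ m) 0) ?_ ?_).seq (n' := 1) ?_)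
  · simpa using FitsBits.one
  · refine ⟨hs.setCell (by norm_num) _ _, ?_⟩
    rw [State.arr_setCell_same, Term.eval_reg, hs.top, Nat.floor_natCast, h5']
    funext j
    simp [sumMass, Function.update_apply]
  rintro s ⟨hs, h5'⟩
  refine Achieves.assign ?_ ?_
  · simpa using FitsBits.zero
  · exact ⟨hs.setReg (by norm_num) _, by simpa using h5', by simp⟩

omit hD in
theorem bins_le (hK : 0 < D.K) : 2 * 2 ^ m + 1 ≤ 2 ^ (100 * β) :=
  (total_le hβ (Nat.succ_le_succ (Nat.le_mul_of_pos_right _ hK))).trans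
    (Nat.pow_le_pow_right (by norm_num) (by omega))

theorem clearProgram_achieves {s : State} (hs : Ready D V (2 ^ m) s) {k : ℕ} (h11 : s.reg 11 = k)
    {A : ℕ → ℚ} (h5 : s.arr 5 = A) :
    Achieves (100 * β) clearProgram s ((2 * 2 ^ m + 1) * 4 + 2) fun s' =>
      Ready D V (2 ^ m) s' ∧ s'.reg 11 = k ∧ s'.arr 5 = A ∧ ∀ a < 2 * 2 ^ m + 1, s'.arr 4 a = 0 := by
  refine ((Achieves.assign (Post := fun s' => Ready D V (2 ^ m) s' ∧ s'.reg 11 = k ∧ s'.arr 5 = A ∧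
    s'.reg 13 = 0) ?_ ?_).seq (n' := (2 * 2 ^ m + 1) * 4 + 1) ?_).mono
    (by simp only [Term.cost_const]; omega) fun _ h => h
  · simpa using FitsBits.zero
  · exact ⟨hs.setReg (by norm_num) _, by simp [h11], by simp [h5], by simp⟩
  rintro s ⟨hs, h11, h5, h13⟩
  refine (Achieves.countLoop (n := 1) (J := 2 * 2 ^ m + 1) (fun j s => Ready D V (2 ^ m) s ∧
    s.reg 11 = k ∧ s.arr 5 = A ∧ s.reg 13 = j ∧ ∀ a < j, s.arr 4 a = 0)
    (fun j s h => ⟨h.2.2.2.1, h.1.bins⟩) (bins_le hβ hD.K_pos) ?_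
    ⟨hs, h11, h5, by simpa using h13, by simp⟩).mono le_rfl
    fun _ h => ⟨h.1, h.2.1, h.2.2.1, h.2.2.2.2⟩
  rintro j hj s ⟨hs, h11, h5, h13, h4⟩
  refine Achieves.store ?_ ?_
  · simpa using FitsBits.zero
  · refine ⟨by simpa using h13, (hs.setCell (by norm_num) _ _).setReg (by norm_num) _,
      by simp [h11], ?_, by simp, ?_⟩
    · rw [State.arr_setReg, State.arr_setCell_of_ne _ (by norm_num), h5]
    · intro a ha
      rw [State.arr_setReg, State.arr_setCell_same, Term.eval_reg, h13, Nat.floor_natCast,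
        Function.update_apply]
      split_ifs with h
      · simp
      · exact h4 a (by omega)

theorem binProgram_achieves (hV0 : 0 < V) (hV : D.IsMaxSqSum (D.K * D.L) V) {s : State}
    (hs : Ready D V (2 ^ m) s) {k : ℕ} (hk : k < D.K) (h11 : s.reg 11 = k) {A : ℕ → ℚ}
    (h5 : s.arr 5 = A) (h4 : ∀ a < 2 * 2 ^ m + 1, s.arr 4 a = 0) :
    Achieves (100 * β) binProgram s (D.L * 63 + 2) fun s' =>
      Ready D V (2 ^ m) s' ∧ s'.reg 11 = k ∧ s'.arr 5 = A ∧
        ∀ a < 2 * 2 ^ m + 1, s'.arr 4 a = D.binMass V (2 ^ m) k D.L a := by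
  have hu := hβ.u_le
  have hmβ := hβ.m_le
  have h1β := hβ.pos
  have hLβ : D.L ≤ 2 ^ β := hβ.L_le.trans Nat.lt_two_pow_self.le
  refine ((Achieves.assign (Post := fun s' => Ready D V (2 ^ m) s' ∧ s'.reg 11 = k ∧ s'.arr 5 = A ∧
    (∀ a < 2 * 2 ^ m + 1, s'.arr 4 a = 0) ∧ s'.reg 12 = 0) ?_ ?_).seq (n' := D.L * 63 + 1) ?_).mono
    (by simp only [Term.cost_const]; omega) fun _ h => h
  · simpa using FitsBits.zero
  · exact ⟨hs.setReg (by norm_num) _, by simp [h11], by simp [h5], by simpa using h4, by simp⟩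
  rintro s ⟨hs, h11, h5, h4, h12⟩
  refine (Achieves.countLoop (n := 60) (J := D.L) (fun j s => Ready D V (2 ^ m) s ∧
    s.reg 11 = k ∧ s.arr 5 = A ∧ s.reg 12 = j ∧
    ∀ a < 2 * 2 ^ m + 1, s.arr 4 a = D.binMass V (2 ^ m) k j a)
    (fun j s h => ⟨h.2.2.2.1, h.1.L⟩)
    (hLβ.trans (Nat.pow_le_pow_right (by norm_num) (by omega))) ?_
    ⟨hs, h11, h5, by simpa using h12, by simpa [binMass] using h4⟩).mono le_rfl
    fun _ h => ⟨h.1, h.2.1, h.2.2.1, h.2.2.2.2⟩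
  rintro j hj s ⟨hs, h11, h5, h12, h4⟩
  have hidx : k * D.L + j < D.K * D.L :=
    calc k * D.L + j < k * D.L + D.L := by omega
      _ = (k + 1) * D.L := (Nat.succ_mul _ _).symm
      _ ≤ _ := Nat.mul_le_mul_right _ hk
  have hdiv : (k * D.L + j) / D.L = k := by
    rw [mul_comm, Nat.mul_add_div hD.L_pos, Nat.div_eq_of_lt hj, add_zero]
  have hKL : D.K * D.L ≤ 2 ^ β :=
    ((Nat.le_mul_of_pos_right _ (by omega)).trans hβ.data).trans Nat.lt_two_pow_self.le
  -- The target bin lies in the cleared range because the gap is at most `V`; outside this range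
  -- nothing is known about array 4.
  have hgrid : D.grid V (2 ^ m) (k * D.L + j) < 2 * 2 ^ m + 1 :=
    Nat.lt_succ_of_le (grid_le hV0 _ ((gap_abs_le _).trans (hV.le _ hidx)))
  have ei : atomIndex.eval s = (k * D.L + j : ℕ) := by
    simp [atomIndex, h11, h12, hs.L]
  have f1 : FitsBits (100 * β) ((k : ℚ) * D.L) := by
    exact_mod_cast (FitsBits.natCast (n := k * D.L) (b := β) (by omega)).mono (by omega)
  have f2 : FitsBits (100 * β) ((k : ℚ) * D.L + j) := by
    exact_mod_cast (FitsBits.natCast (n := k * D.L + j) (b := β) (by omega)).mono (by omega)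
  have ci : ∀ q ∈ atomIndex.computed s, FitsBits (100 * β) q := by
    simpa [atomIndex, h11, h12, hs.L] using ⟨f1, f2⟩
  have fy := (hD.x_fits (k * D.L + j)).sub (hD.y_fits k)
  have fz := (hD.x_fits (k * D.L + j)).sub (hD.z_fits k)
  have ey : atomDevY.eval s = D.x (k * D.L + j) - D.y k := by
    rw [atomDevY, Term.eval_sub, Term.eval_cell, Term.eval_cell, ei, Term.eval_reg, h11,
      Nat.floor_natCast, Nat.floor_natCast, hs.x, hs.y]
  have ez : atomDevZ.eval s = D.x (k * D.L + j) - D.z k := by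
    rw [atomDevZ, Term.eval_sub, Term.eval_cell, Term.eval_cell, ei, Term.eval_reg, h11,
      Nat.floor_natCast, Nat.floor_natCast, hs.x, hs.z]
  have cy : ∀ q ∈ atomDevY.computed s, FitsBits (100 * β) q := by
    have hc : atomDevY.computed s = atomIndex.computed s ++ [] ++ [atomDevY.eval s] := rfl
    rw [hc, ey]
    simp only [List.append_nil, List.mem_append, List.mem_singleton]
    rintro q (h | rfl)
    exacts [ci q h, fy.mono (by omega)]
  have cz : ∀ q ∈ atomDevZ.computed s, FitsBits (100 * β) q := by
    have hc : atomDevZ.computed s = atomIndex.computed s ++ [] ++ [atomDevZ.eval s] := rfl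
    rw [hc, ez]
    simp only [List.append_nil, List.mem_append, List.mem_singleton]
    rintro q (h | rfl)
    exacts [ci q h, fz.mono (by omega)]
  have fN : FitsBits β ((2 ^ m : ℕ) : ℚ) :=
    FitsBits.natCast (Nat.pow_le_pow_right (by norm_num) hmβ)
  have fgap := (hD.gap_fits (k * D.L + j)).mono (b := 13 * β) (by omega)
  have fV := hV.fits hD hβ
  have egap : (atomDevY * atomDevY - atomDevZ * atomDevZ).eval s = D.gap (k * D.L + j) := by
    rw [Term.eval_sub, Term.eval_mul, Term.eval_mul, ey, ez, gap, hdiv]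
  have eb : atomBin.eval s = D.gap (k * D.L + j) * (2 ^ m : ℕ) / V + (2 ^ m : ℕ) := by
    rw [atomBin, Term.eval_add, Term.eval_div, Term.eval_mul, egap, Term.eval_reg, Term.eval_reg,
      hs.resolution, hs.scale]
  have cb : ∀ q ∈ atomBin.computed s, FitsBits (100 * β) q := by
    have hc : atomBin.computed s =
      (atomDevY * atomDevY - atomDevZ * atomDevZ).computed s ++ [] ++
        [D.gap (k * D.L + j) * (2 ^ m : ℕ)] ++ [] ++ [D.gap (k * D.L + j) * (2 ^ m : ℕ) / V] ++ []
        ++ [D.gap (k * D.L + j) * (2 ^ m : ℕ) / V + (2 ^ m : ℕ)] := by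
      rw [atomBin, Term.computed_add, Term.computed_div, Term.computed_mul, Term.eval_div,
        Term.eval_mul, egap, Term.computed_reg, Term.computed_reg, Term.eval_reg, Term.eval_reg,
        hs.resolution, hs.scale]
    rw [hc]
    simp only [List.append_nil, List.mem_append, List.mem_singleton, Term.computed_sub,
      Term.computed_mul, ey, ez, Term.eval_mul]
    have hg : FitsBits (100 * β) ((D.x (k * D.L + j) - D.y k) * (D.x (k * D.L + j) - D.y k) -
        (D.x (k * D.L + j) - D.z k) * (D.x (k * D.L + j) - D.z k)) :=
      ((fy.mul fy).sub (fz.mul fz)).mono (by omega)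
    rintro q (((((((h | h) | rfl) | (h | h) | rfl) | rfl) | rfl) | rfl) | rfl)
    exacts [cy q h, cy q h, (fy.mul fy).mono (by omega), cz q h, cz q h,
      (fz.mul fz).mono (by omega), hg, (fgap.mul fN).mono (by omega),
      ((fgap.mul fN).div fV).mono (by omega), (((fgap.mul fN).div fV).add fN).mono (by omega)]
  have eg : ⌊atomBin.eval s⌋₊ = D.grid V (2 ^ m) (k * D.L + j) := by
    rw [eb, grid]
  have es : (Term.cell 4 atomBin + .cell 0 atomIndex).eval s =
      D.binMass V (2 ^ m) k (j + 1) (D.grid V (2 ^ m) (k * D.L + j)) := by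
    rw [Term.eval_add, Term.eval_cell, Term.eval_cell, eg, ei, Nat.floor_natCast, h4 _ hgrid, hs.p,
      binMass, binMass, Finset.sum_range_succ, if_pos rfl]
  have fs := hD.binMass_fits' hβ V (2 ^ m) k (D.grid V (2 ^ m) (k * D.L + j))
    (show j + 1 ≤ D.L from hj)
  refine (Achieves.store ?_ ?_).mono ?_ fun _ h => h
  · rw [es, Term.computed_add, ← Term.eval_add, es]
    simp only [Term.computed_cell, List.mem_append, List.mem_singleton]
    rintro q ((h | (h | h) | rfl) | rfl)
    exacts [cb q h, cb q h, ci q h, fs.mono (by omega), fs.mono (by omega)]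
  · rw [es, eg]
    refine ⟨by simpa using h12, (hs.setCell (by norm_num) _ _).setReg (by norm_num) _,
      by simp [h11], ?_, by simp, ?_⟩
    · rw [State.arr_setReg, State.arr_setCell_of_ne _ (by norm_num), h5]
    · intro a ha
      rw [State.arr_setReg, State.arr_setCell_same, Function.update_apply]
      split_ifs with h
      · rw [h]
      · rw [h4 a ha, binMass, binMass, Finset.sum_range_succ, if_neg h, add_zero]
  · simp [atomBin, atomDevY, atomDevZ, atomIndex]

end Main

end RatRam

/-! ### In-place convolution and evaluation of the truncated sum -/

namespace RatRam

open FlatInstance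

variable {D : FlatInstance} {u m β : ℕ} {V : ℚ}

section Main
variable (hD : D.IsValid u) (hβ : D.SizeBound u m β)
include hD hβ

/-- Array 5 is only assumed to hold the old law from cell `j` upwards: the cells below have already
been overwritten when the product at `j` is formed. -/
theorem dotProgram_achieves {s : State} (hs : Ready D V (2 ^ m) s) {k : ℕ} (hk : k < D.K)
    (h11 : s.reg 11 = k) {j : ℕ} (hj : j ≤ 2 * 2 ^ m * D.K) (h13 : s.reg 13 = j) {A B : ℕ → ℚ}
    (h5 : s.arr 5 = A) (h4 : s.arr 4 = B)
    (hA : ∀ n, j ≤ n → A n = D.sumMass V (2 ^ m) k n)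
    (hB : ∀ a < 2 * 2 ^ m + 1, B a = D.binMass V (2 ^ m) k D.L a) :
    Achieves (100 * β) dotProgram s ((2 * 2 ^ m + 1) * 9 + 3) fun s' =>
      Ready D V (2 ^ m) s' ∧ s'.reg 11 = k ∧ s'.reg 13 = j ∧ s'.arr 5 = A ∧ s'.arr 4 = B ∧
        s'.reg 15 = D.sumMass V (2 ^ m) (k + 1) j := by
  have h1β := hβ.pos
  refine ((Achieves.assign (Post := fun s' => Ready D V (2 ^ m) s' ∧ s'.reg 11 = k ∧
    s'.reg 13 = j ∧ s'.arr 5 = A ∧ s'.arr 4 = B ∧ s'.reg 15 = 0)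
    ?_ ?_).seq (n' := (2 * 2 ^ m + 1) * 9 + 2) ?_).mono
    (by simp only [Term.cost_const]; omega) fun _ h => h
  · simpa using FitsBits.zero
  · exact ⟨hs.setReg (by norm_num) _, by simp [h11], by simp [h13], by simp [h5], by simp [h4],
      by simp⟩
  rintro s ⟨hs, h11, h13, h5, h4, h15⟩
  refine ((Achieves.assign (Post := fun s' => Ready D V (2 ^ m) s' ∧ s'.reg 11 = k ∧
    s'.reg 13 = j ∧ s'.arr 5 = A ∧ s'.arr 4 = B ∧ s'.reg 15 = 0 ∧ s'.reg 14 = 0)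
    ?_ ?_).seq (n' := (2 * 2 ^ m + 1) * 9 + 1) ?_).mono
    (by simp only [Term.cost_const]; omega) fun _ h => h
  · simpa using FitsBits.zero
  · exact ⟨hs.setReg (by norm_num) _, by simp [h11], by simp [h13], by simp [h5], by simp [h4],
      by simp [h15], by simp⟩
  rintro s ⟨hs, h11, h13, h5, h4, h15, h14⟩
  refine (Achieves.countLoop (n := 6) (J := 2 * 2 ^ m + 1) (fun a s => Ready D V (2 ^ m) s ∧
    s.reg 11 = k ∧ s.reg 13 = j ∧ s.arr 5 = A ∧ s.arr 4 = B ∧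
    s.reg 15 = ∑ i ∈ Finset.range a, D.binMass V (2 ^ m) k D.L i * D.sumMass V (2 ^ m) k (j + i) ∧
    s.reg 14 = a) (fun j s h => ⟨h.2.2.2.2.2.2, h.1.bins⟩) (bins_le hβ hD.K_pos) ?_
    ⟨hs, h11, h13, h5, h4, by simpa using h15, by simpa using h14⟩).mono le_rfl
    fun _ h => ⟨h.1, h.2.1, h.2.2.1, h.2.2.2.1, h.2.2.2.2.1, h.2.2.2.2.2.1⟩
  rintro a ha s ⟨hs, h11, h13, h5, h4, h15, h14⟩
  have htot := two_pow_le_total (m := m) hD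
  have haddr : (j : ℚ) + a = (j + a : ℕ) := by push_cast; rfl
  have f0 : FitsBits (100 * β) (((j + a : ℕ) : ℚ)) := by
    push_cast
    exact ((fits_of_le_total hβ (by omega)).add (fits_of_le_total hβ (by omega))).mono (by omega)
  have e1 : s.arr 4 a * s.arr 5 (j + a) =
      D.binMass V (2 ^ m) k D.L a * D.sumMass V (2 ^ m) k (j + a) := by
    rw [h4, h5, hA _ (by omega), hB a ha]
  have f1 : FitsBits (100 * β) (D.binMass V (2 ^ m) k D.L a * D.sumMass V (2 ^ m) k (j + a)) :=
    ((hD.binMass_fits' hβ V _ k a le_rfl).mul (hD.sumMass_fits hβ V _ hk.le _)).mono (by omega)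
  have f2 := (hD.convolution_fits hβ V (2 ^ m) hk j (a + 1)).mono (b := 100 * β) (by omega)
  rw [Finset.sum_range_succ] at f2
  refine Achieves.assign ?_ ?_
  · simp only [Term.computed_add, Term.computed_mul, Term.computed_reg, Term.computed_cell,
      Term.eval_add, Term.eval_mul, Term.eval_cell, Term.eval_reg, h13, h14, haddr,
      Nat.floor_natCast, e1, h15, List.forall_mem_append, List.forall_mem_cons]
    simp only [List.not_mem_nil, IsEmpty.forall_iff, implies_true, true_and, and_true]
    exact ⟨⟨⟨f0, f1⟩, f2⟩, f2⟩
  · refine ⟨by simp [h14], (hs.setReg (by norm_num) _).setReg (by norm_num) _, by simp [h11],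
      by simp [h13], by simp [h5], by simp [h4], ?_, by simp⟩
    rw [Finset.sum_range_succ, ← e1, ← h15]
    rw [State.reg_setReg, if_neg (by norm_num), State.reg_setReg, if_pos rfl, Term.eval_add,
      Term.eval_mul, Term.eval_cell, Term.eval_cell, Term.eval_add, Term.eval_reg, Term.eval_reg,
      Term.eval_reg, h14, h13, haddr, Nat.floor_natCast, Nat.floor_natCast]

/-- Cells count downwards from the largest possible sum, so the new value at `j` depends only on old
values at `j + a` with `a ≥ 0`. Proceeding upwards in `j`, the array can be overwritten in place. -/
theorem convolveProgram_achieves {s : State} (hs : Ready D V (2 ^ m) s) {k : ℕ} (hk : k < D.K)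
    (h11 : s.reg 11 = k) (h5 : s.arr 5 = D.sumMass V (2 ^ m) k)
    (h4 : ∀ a < 2 * 2 ^ m + 1, s.arr 4 a = D.binMass V (2 ^ m) k D.L a) :
    Achieves (100 * β) convolveProgram s
      ((2 * 2 ^ m * D.K + 1) * ((2 * 2 ^ m + 1) * 9 + 7) + 2) fun s' =>
      Ready D V (2 ^ m) s' ∧ s'.reg 11 = k ∧ s'.arr 5 = D.sumMass V (2 ^ m) (k + 1) := by
  have h1β := hβ.pos
  obtain ⟨B, hB⟩ : ∃ B, s.arr 4 = B := ⟨_, rfl⟩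
  rw [hB] at h4
  refine ((Achieves.assign (Post := fun s' => Ready D V (2 ^ m) s' ∧ s'.reg 11 = k ∧
    s'.reg 13 = 0 ∧ s'.arr 5 = D.sumMass V (2 ^ m) k ∧ s'.arr 4 = B) ?_ ?_).seq
    (n' := (2 * 2 ^ m * D.K + 1) * ((2 * 2 ^ m + 1) * 9 + 7) + 1) ?_).mono
    (by simp only [Term.cost_const]; omega) fun _ h => h
  · simpa using FitsBits.zero
  · exact ⟨hs.setReg (by norm_num) _, by simp [h11], by simp, by simp [h5], by simp [hB]⟩
  rintro s ⟨hs, h11, h13, h5, hB⟩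
  refine (Achieves.countLoop (n := (2 * 2 ^ m + 1) * 9 + 4) (J := 2 * 2 ^ m * D.K + 1)
    (fun j s => Ready D V (2 ^ m) s ∧ s.reg 11 = k ∧ s.reg 13 = j ∧
    (∀ n, s.arr 5 n = if n < j then D.sumMass V (2 ^ m) (k + 1) n else D.sumMass V (2 ^ m) k n) ∧
    s.arr 4 = B) (fun j s h => ⟨h.2.2.1, h.1.cells⟩)
    ((total_le hβ le_rfl).trans (Nat.pow_le_pow_right (by norm_num) (by omega))) ?_
    ⟨hs, h11, by simpa using h13, by simp [h5], hB⟩).mono le_rfl ?_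
  swap
  · rintro s ⟨hs, h11, -, h5, -⟩
    refine ⟨hs, h11, funext fun n => ?_⟩
    rw [h5]
    split_ifs with h
    · rfl
    -- Cells beyond the last one visited are 0 in the old and in the new law.
    · rw [sumMass_eq_zero _ _ _ (by omega), sumMass_eq_zero _ _ _ (by omega)]
  rintro j hj s ⟨hs, h11, h13, h5, hB⟩
  obtain ⟨A, hA⟩ : ∃ A, s.arr 5 = A := ⟨_, rfl⟩
  rw [hA] at h5
  refine ((dotProgram_achieves hD hβ hs hk h11 (by omega) h13 hA hB ?_ h4).seq (n' := 1) ?_)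
  · intro n hn
    rw [h5, if_neg (by omega)]
  rintro s ⟨hs, h11, h13, hA, hB, h15⟩
  refine Achieves.store ?_ ?_
  · simpa [h15] using (hD.sumMass_fits hβ V (2 ^ m) hk j).mono (by omega)
  · refine ⟨by simp [h13], (hs.setCell (by norm_num) _ _).setReg (by norm_num) _, by simp [h11],
      by simp, fun n => ?_, ?_⟩
    · rw [State.arr_setReg, State.arr_setCell_same, Term.eval_reg, Term.eval_reg, h13, h15,
        Nat.floor_natCast, Function.update_apply, hA, h5]
      split_ifs <;> first | rfl | omega | (congr 1; omega)
    · rw [State.arr_setReg, State.arr_setCell_of_ne _ (by norm_num), hB]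

theorem sumProgram_achieves (hV0 : 0 < V) (hV : D.IsMaxSqSum (D.K * D.L) V) {s : State}
    (hs : Ready D V (2 ^ m) s) (h11 : s.reg 11 = 0) (h5 : s.arr 5 = D.sumMass V (2 ^ m) 0) :
    Achieves (100 * β) sumProgram s
      (D.K * (((2 * 2 ^ m + 1) * 4 + 2) + ((D.L * 63 + 2) +
        ((2 * 2 ^ m * D.K + 1) * ((2 * 2 ^ m + 1) * 9 + 7) + 2)) + 3) + 1) fun s' =>
      Ready D V (2 ^ m) s' ∧ s'.arr 5 = D.sumMass V (2 ^ m) D.K := by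
  have h1β := hβ.pos
  refine (Achieves.countLoop (J := D.K) (fun k s => Ready D V (2 ^ m) s ∧ s.reg 11 = k ∧
    s.arr 5 = D.sumMass V (2 ^ m) k) (fun j s h => ⟨h.2.1, h.1.K⟩)
    ((hβ.K_le.trans Nat.lt_two_pow_self.le).trans (Nat.pow_le_pow_right (by norm_num) (by omega)))
    ?_ ⟨hs, by simpa using h11, h5⟩).mono le_rfl fun _ h => ⟨h.1, h.2.2⟩
  rintro k hk s ⟨hs, h11, h5⟩
  refine (clearProgram_achieves hD hβ hs h11 h5).seq ?_
  rintro s ⟨hs, h11, h5, h4⟩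
  refine (binProgram_achieves hD hβ hV0 hV hs hk h11 h5 h4).seq ?_
  rintro s ⟨hs, h11, h5, h4⟩
  refine (convolveProgram_achieves hD hβ hs hk h11 h5 h4).mono le_rfl ?_
  rintro s ⟨hs, h11, h5⟩
  exact ⟨h11, hs.setReg (by norm_num) _, by simp, by simpa using h5⟩

theorem evalProgram_achieves (hV : D.IsMaxSqSum (D.K * D.L) V) {s : State}
    (hs : Ready D V (2 ^ m) s) (h5 : s.arr 5 = D.sumMass V (2 ^ m) D.K) :
    Achieves (100 * β) evalProgram s (2 * 2 ^ m * D.K * 10 + 11) fun s' =>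
      s'.output = D.approxValue V (2 ^ m) := by
  have h1β := hβ.pos
  have hu := hβ.u_le
  have hmβ := hβ.m_le
  have h0 (s : State) : ∀ q ∈ (Term.const 0).computed s ++ [(Term.const 0).eval s],
      FitsBits (100 * β) q := by
    simpa using FitsBits.zero
  refine ((Achieves.assign (Post := fun s' => Ready D V (2 ^ m) s' ∧
    s'.arr 5 = D.sumMass V (2 ^ m) D.K ∧ s'.reg 16 = 0) (h0 _) ?_).seq
    (n' := 2 * 2 ^ m * D.K * 10 + 10) ?_).mono
    (by simp only [Term.cost_const]; omega) fun _ h => h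
  · exact ⟨hs.setReg (by norm_num) _, by simp [h5], by simp⟩
  rintro s ⟨hs, h5, h16⟩
  refine ((Achieves.assign (Post := fun s' => Ready D V (2 ^ m) s' ∧
    s'.arr 5 = D.sumMass V (2 ^ m) D.K ∧ s'.reg 16 = 0 ∧ s'.reg 15 = 0) (h0 _) ?_).seq
    (n' := 2 * 2 ^ m * D.K * 10 + 9) ?_).mono
    (by simp only [Term.cost_const]; omega) fun _ h => h
  · exact ⟨hs.setReg (by norm_num) _, by simp [h5], by simp [h16], by simp⟩
  rintro s ⟨hs, h5, h16, h15⟩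
  refine ((Achieves.assign (Post := fun s' => Ready D V (2 ^ m) s' ∧
    s'.arr 5 = D.sumMass V (2 ^ m) D.K ∧ s'.reg 16 = 0 ∧ s'.reg 15 = 0 ∧ s'.reg 13 = 0) (h0 _) ?_).seq
    (n' := 2 * 2 ^ m * D.K * 10 + 8) ?_).mono
    (by simp only [Term.cost_const]; omega) fun _ h => h
  · exact ⟨hs.setReg (by norm_num) _, by simp [h5], by simp [h16], by simp [h15], by simp⟩
  rintro s ⟨hs, h5, h16, h15, h13⟩
  refine ((Achieves.countLoop (n := 7) (J := 2 * 2 ^ m * D.K) (fun j s => Ready D V (2 ^ m) s ∧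
    s.arr 5 = D.sumMass V (2 ^ m) D.K ∧ s.reg 16 = D.cumMass V (2 ^ m) j ∧
    s.reg 15 = D.truncSum V (2 ^ m) j ∧ s.reg 13 = j) (fun j s h => ⟨h.2.2.2.2, h.1.top⟩)
    ((total_le hβ (by omega)).trans (Nat.pow_le_pow_right (by norm_num) (by omega))) ?_
    ⟨hs, h5, by simpa [cumMass] using h16, by simpa [truncSum] using h15,
      by simpa using h13⟩).seq (n' := 7) ?_)
  · rintro j hj s ⟨hs, h5, h16, h15, h13⟩
    have hsub : ((2 * 2 ^ m * D.K : ℕ) : ℚ) - j = (2 * 2 ^ m * D.K - j : ℕ) := by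
      rw [Nat.cast_sub hj.le]
    have e1 : D.cumMass V (2 ^ m) j + s.arr 5 (2 * 2 ^ m * D.K - j) =
        D.cumMass V (2 ^ m) (j + 1) := by
      rw [h5, cumMass, cumMass, Finset.sum_range_succ]
    have f1 : FitsBits (100 * β) (((2 * 2 ^ m * D.K - j : ℕ) : ℚ)) :=
      (fits_of_le_total hβ (by omega)).mono (by omega)
    have f2 := (hD.cumMass_fits hβ V (2 ^ m) (j := j + 1) (by omega)).mono (b := 100 * β) (by omega)
    have f3 := (hD.truncSum_fits hβ V (2 ^ m) (j := j + 1) (by omega)).mono (b := 100 * β)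
      (by omega)
    have e3 : D.truncSum V (2 ^ m) (j + 1) =
        D.truncSum V (2 ^ m) j + min D.t (D.cumMass V (2 ^ m) (j + 1)) := by
      rw [truncSum, truncSum, Finset.sum_range_succ]
    refine (Achieves.assign (Post := fun s => Ready D V (2 ^ m) s ∧
      s.arr 5 = D.sumMass V (2 ^ m) D.K ∧ s.reg 16 = D.cumMass V (2 ^ m) (j + 1) ∧
      s.reg 15 = D.truncSum V (2 ^ m) j ∧ s.reg 13 = j) ?_ ?_).seq (n' := 3) ?_
    · simp only [Term.computed_add, Term.computed_sub, Term.computed_reg, Term.computed_cell,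
        Term.eval_add, Term.eval_sub, Term.eval_cell, Term.eval_reg, h13, hs.top, hsub,
        Nat.floor_natCast, e1, h16, List.forall_mem_append, List.forall_mem_cons]
      simp only [List.not_mem_nil, IsEmpty.forall_iff, implies_true, true_and, and_true]
      exact ⟨⟨f1, f2⟩, f2⟩
    · refine ⟨hs.setReg (by norm_num) _, by simp [h5], ?_, by simp [h15], by simp [h13]⟩
      rw [State.reg_setReg, if_pos rfl, Term.eval_add, Term.eval_cell, Term.eval_sub, Term.eval_reg,
        Term.eval_reg, Term.eval_reg, h13, hs.top, hsub, Nat.floor_natCast, h16, e1]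
    rintro s ⟨hs, h5, h16, h15, h13⟩
    -- The branch adds the minimum of `t` and the cumulative mass, which is the summand in `e3`.
    refine Achieves.branch (n := 2) (by simp) ?_ ?_
    · intro hlt
      rw [Term.eval_reg, Term.eval_reg, hs.t, h16] at hlt
      rw [min_eq_left hlt.le] at e3
      refine Achieves.assign ?_ ?_
      · simpa [h15, hs.t, ← e3] using f3
      · exact ⟨by simp [h13], (hs.setReg (by norm_num) _).setReg (by norm_num) _, by simp [h5],
          by simp [h16], by simp [h15, hs.t, e3], by simp⟩
    · intro hlt
      rw [Term.eval_reg, Term.eval_reg, hs.t, h16, not_lt] at hlt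
      rw [min_eq_right hlt] at e3
      refine Achieves.assign ?_ ?_
      · simpa [h15, h16, ← e3] using f3
      · exact ⟨by simp [h13], (hs.setReg (by norm_num) _).setReg (by norm_num) _, by simp [h5],
          by simp [h16], by simp [h15, h16, e3], by simp⟩
  · rintro s ⟨hs, h5, -, h15, -⟩
    have fE := hD.meanCost_fits' hβ le_rfl
    have fV := hV.fits hD hβ
    have fN : FitsBits β ((2 ^ m : ℕ) : ℚ) :=
      FitsBits.natCast (Nat.pow_le_pow_right (by norm_num) hmβ)
    have fK : FitsBits β (D.K : ℚ) := FitsBits.natCast (hβ.K_le.trans Nat.lt_two_pow_self.le)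
    have ft := hD.t_fits.mono hu
    have fT := hD.truncSum_fits hβ V (2 ^ m) (j := 2 * 2 ^ m * D.K) (by omega)
    have fs := ((fK.mul fN).mul ft).sub fT
    have fp := (fV.div fN).mul fs
    refine (Achieves.assign ?_ ?_)
    · simp only [Term.computed_add, Term.computed_sub, Term.computed_mul, Term.computed_div,
        Term.computed_reg, Term.eval_add, Term.eval_sub, Term.eval_mul, Term.eval_div,
        Term.eval_reg, hs.mean, hs.scale, hs.resolution, hs.K, hs.t, h15,
        List.forall_mem_append, List.forall_mem_cons]
      simp only [List.not_mem_nil, IsEmpty.forall_iff, implies_true, true_and, and_true]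
      have fo := (fE.add fp).mono (b := 100 * β) (by omega)
      exact ⟨⟨⟨⟨(fV.div fN).mono (by omega), ⟨(fK.mul fN).mono (by omega),
        ((fK.mul fN).mul ft).mono (by omega)⟩, fs.mono (by omega)⟩, fp.mono (by omega)⟩, fo⟩, fo⟩
    · simp only [State.output, State.reg_setReg, if_true, Term.eval_add, Term.eval_sub,
        Term.eval_mul, Term.eval_div, Term.eval_reg, hs.mean, hs.scale, hs.resolution, hs.K, hs.t,
        h15, approxValue]

end Main

end RatRam

/-! ### Total operation count -/

namespace RatRam

open FlatInstance

variable {D : FlatInstance} {u m β : ℕ} {V : ℚ}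

theorem transportProgram_achieves_approxValue (hD : D.IsValid u) (hβ : D.SizeBound u m β)
    (hε : 0 < D.ε) (hV : D.IsMaxSqSum (D.K * D.L) V) (hm : ∀ j < m, D.ε < D.K * V / 2 ^ j)
    (hm' : D.K * V / 2 ^ m ≤ D.ε) {s : State} (hs : Holds D s) (h5 : s.reg 5 = 0)
    (h6 : s.reg 6 = 0) (h11 : s.reg 11 = 0) (h5' : s.arr 5 = 0) :
    Achieves (100 * β) transportProgram s
      (D.K * D.L * 58 + 7 + if D.ε < D.K * V then 300 * (D.K * D.L + D.K ^ 2 * (2 ^ m) ^ 2) else 0)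
      fun s' => s'.output = if D.ε < D.K * V then D.approxValue V (2 ^ m) else 0 := by
  have h1β := hβ.pos
  refine ((scanProgram_achieves hD hβ hs h5 h6 h11 h5').seq
    (n' := 4 + if D.ε < D.K * V then 300 * (D.K * D.L + D.K ^ 2 * (2 ^ m) ^ 2) else 0) ?_).mono
    (by omega) fun _ h => h
  rintro s ⟨hs, hV', h6, h5'⟩
  have hVV : s.reg 5 = V := hV'.unique hV
  have fV := hV.fits hD hβ
  refine ((Achieves.assign (Post := fun s' => Holds D s' ∧ s'.reg 5 = V ∧
    s'.reg 6 = D.meanCost (D.K * D.L) ∧ s'.reg 8 = D.K * V ∧ s'.arr 5 = 0) ?_ ?_).seq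
    (n' := 1 + (if D.ε < D.K * V then 300 * (D.K * D.L + D.K ^ 2 * (2 ^ m) ^ 2) else 1)) ?_).mono
    ?_ fun _ h => h
  · have f8 : FitsBits (100 * β) (D.K * V) :=
      ((FitsBits.natCast (b := β) (hβ.K_le.trans Nat.lt_two_pow_self.le)).mul fV).mono (by omega)
    simpa [hs.K, hVV] using f8
  · exact ⟨hs.setReg (by norm_num) _, by simp [hVV], by simp [h6], by simp [hs.K, hVV], by simp [h5']⟩
  swap
  · simp only [Term.cost_mul, Term.cost_reg]
    split_ifs <;> omega
  rintro s ⟨hs, h5, h6, h8, h5'⟩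
  refine (Achieves.branch (n := if D.ε < D.K * V then 300 * (D.K * D.L + D.K ^ 2 * (2 ^ m) ^ 2)
    else 1) (by simp) ?_ ?_).mono (by simp) fun _ h => h
  · intro hlt
    rw [Term.eval_reg, Term.eval_reg, hs.ε, h8] at hlt
    -- On this branch the division by `V` in the bin index is legitimate.
    have hV0 : 0 < V := by
      have h : 0 < (D.K : ℚ) * V := hε.trans hlt
      exact pos_of_mul_pos_right h (Nat.cast_nonneg _)
    simp only [if_pos hlt]
    refine ((refineProgram_achieves hβ fV hs h5 h6 h8 hm hm' h5').seq
      (n' := 10 + ((D.K * (((2 * 2 ^ m + 1) * 4 + 2) + ((D.L * 63 + 2) +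
        ((2 * 2 ^ m * D.K + 1) * ((2 * 2 ^ m + 1) * 9 + 7) + 2)) + 3) + 1) +
        (2 * 2 ^ m * D.K * 10 + 11))) ?_).mono ?_ fun _ h => h
    · rintro s ⟨hs, h5, h6, h7, h5'⟩
      refine (setupProgram_achieves hD hβ hs h5 h6 h7 h5').seq ?_
      rintro s ⟨hs, h5, h11⟩
      refine (sumProgram_achieves hD hβ hV0 hV hs h11 h5).seq ?_
      rintro s ⟨hs, h5⟩
      exact evalProgram_achieves hD hβ hV hs h5
    -- The doublings cost O(m) ≤ O(N), and since `K` and `N` are at least 1, all lower-order terms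
    -- are dominated by `K ^ 2 * N ^ 2`, except those of order `K * L`.
    · have h1 : m ≤ 2 ^ m := Nat.lt_two_pow_self.le
      have h2 : 1 ≤ 2 ^ m := Nat.one_le_two_pow
      generalize 2 ^ m = N at h1 h2 ⊢
      have hK := hD.K_pos
      have hL := hD.L_pos
      have a1 : N ≤ D.K ^ 2 * N ^ 2 := by nlinarith [Nat.mul_le_mul hK h2, sq_nonneg (D.K * N)]
      have a2 : D.K * N ≤ D.K ^ 2 * N ^ 2 := by nlinarith [Nat.mul_le_mul hK h2]
      have a3 : D.K ≤ D.K * N := Nat.le_mul_of_pos_right _ h2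
      have a4 : D.K ^ 2 * N ≤ D.K ^ 2 * N ^ 2 := Nat.mul_le_mul_left _ (by nlinarith)
      nlinarith
  · intro hlt
    rw [Term.eval_reg, Term.eval_reg, hs.ε, h8] at hlt
    simp only [if_neg hlt]
    refine Achieves.assign ?_ ?_
    · simpa using FitsBits.zero
    · simp [State.output]

end RatRam

/-! ### Transport to two points -/

section TwoPoint

variable {I : Type*} [Fintype I] {μ φ : I → ℝ} {S : I → ℕ} {M : ℕ} {t : ℝ}

/-- Layer-cake formula: `M - S i` is the number of `s < M` with `S i ≤ s`. -/
theorem sum_mul_natCast_eq (hS : ∀ i, S i ≤ M) (hφ : ∑ i, φ i = t) :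
    ∑ i, φ i * (S i : ℝ) =
      M * t - ∑ s ∈ Finset.range M, ∑ i, if S i < s + 1 then φ i else 0 := by
  rw [Finset.sum_comm, ← hφ, Finset.mul_sum, ← Finset.sum_sub_distrib]
  refine Finset.sum_congr rfl fun i _ => ?_
  have h1 : ∑ s ∈ Finset.range M, (if S i < s + 1 then φ i else 0) = (M - S i : ℕ) * φ i := by
    rw [← Finset.sum_filter, Finset.sum_const, nsmul_eq_mul]
    congr 2
    rw [← Nat.card_Ico]
    congr 1
    ext s
    simp only [Finset.mem_filter, Finset.mem_range, Finset.mem_Ico]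
    omega
  rw [h1, Nat.cast_sub (hS i)]
  ring

/-- The greedy plan attains the truncated cumulative masses. -/
theorem exists_greedy (hμ : ∀ i, 0 ≤ μ i) (hμ1 : ∑ i, μ i = 1) (ht : 0 ≤ t) (ht1 : t ≤ 1)
    (S : I → ℕ) : ∃ φ : I → ℝ, (∀ i, 0 ≤ φ i) ∧ (∀ i, φ i ≤ μ i) ∧ ∑ i, φ i = t ∧
      ∀ n, (∑ i, if S i < n then φ i else 0) = min t (∑ i, if S i < n then μ i else 0) := by
  set Q : ℕ → ℝ := fun n => ∑ i, if S i < n then μ i else 0 with hQ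
  set q : ℕ → ℝ := fun n => ∑ i, if S i = n then μ i else 0 with hq
  have hsplit : ∀ (f : I → ℝ) n, (∑ i, if S i < n + 1 then f i else 0) =
      (∑ i, if S i < n then f i else 0) + ∑ i, if S i = n then f i else 0 := by
    intro f n
    rw [← Finset.sum_add_distrib]
    refine Finset.sum_congr rfl fun i _ => ?_
    rcases lt_trichotomy (S i) n with h | h | h
    · simp [h, h.ne, Nat.lt_succ_of_lt h]
    · simp [h]
    · simp [h.ne', h.not_gt]
      intro h'
      omega
  have hQs : ∀ n, Q (n + 1) = Q n + q n := hsplit μ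
  have hq0 : ∀ n, 0 ≤ q n := fun n => Finset.sum_nonneg fun i _ => by
    split_ifs
    exacts [hμ i, le_rfl]
  have hd0 : ∀ n, 0 ≤ min t (Q (n + 1)) - min t (Q n) := fun n => by
    rw [sub_nonneg]
    exact min_le_min le_rfl (by rw [hQs]; linarith [hq0 n])
  -- Truncation at `t` is 1-Lipschitz, so its increment is at most the mass of the level set.
  have hd1 : ∀ n, min t (Q (n + 1)) - min t (Q n) ≤ q n := fun n => by
    rw [hQs]
    have := hq0 n
    rcases le_total t (Q n) with h | h
    · rw [min_eq_left h, min_eq_left (by linarith)]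
      linarith
    · rw [min_eq_right h]
      linarith [min_le_right t (Q n + q n)]
  -- The fraction taken from the level set `S = n`: 1 before the threshold, 0 beyond it. On a level
  -- of mass zero the division gives 0, consistently with a vanishing increment.
  set r : ℕ → ℝ := fun n => (min t (Q (n + 1)) - min t (Q n)) / q n with hr
  have hr0 : ∀ n, 0 ≤ r n := fun n => div_nonneg (hd0 n) (hq0 n)
  have hr1 : ∀ n, r n ≤ 1 := fun n => div_le_one_of_le₀ (hd1 n) (hq0 n)
  have hrq : ∀ n, r n * q n = min t (Q (n + 1)) - min t (Q n) := by
    intro n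
    rcases eq_or_ne (q n) 0 with h | h
    · rw [h, mul_zero]
      linarith [hd0 n, hd1 n]
    · exact div_mul_cancel₀ _ h
  have hcum : ∀ n, (∑ i, if S i < n then μ i * r (S i) else 0) = min t (Q n) := by
    intro n
    induction n with
    | zero => simp [hQ, ht]
    | succ n ih =>
      rw [hsplit, ih]
      have : (∑ i, if S i = n then μ i * r (S i) else 0) = r n * q n := by
        rw [hq, Finset.mul_sum]
        refine Finset.sum_congr rfl fun i _ => ?_
        split_ifs with h
        · rw [h, mul_comm]
        · simp
      rw [this, hrq]
      ring
  refine ⟨fun i => μ i * r (S i), fun i => mul_nonneg (hμ i) (hr0 _),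
    fun i => mul_le_of_le_one_right (hμ i) (hr1 _), ?_, hcum⟩
  obtain ⟨n, hn⟩ : ∃ n, ∀ i, S i < n :=
    ⟨Finset.univ.sup S + 1, fun i => Nat.lt_succ_of_le (Finset.le_sup (Finset.mem_univ i))⟩
  have h1 := hcum n
  have h2 : Q n = 1 := by
    rw [← hμ1]
    exact Finset.sum_congr rfl fun i _ => if_pos (hn i)
  rw [h2, min_eq_left ht1] at h1
  rw [← h1]
  exact Finset.sum_congr rfl fun i _ => (if_pos (hn i)).symm

variable {E : Type*} {c : E → E → ℝ} {x : I → E} {y₁ y₂ : E}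

/-- The row sums eliminate the second column, leaving a knapsack problem for the first. -/
theorem transport_cost_eq {π : I → Fin 2 → ℝ} (h : ∀ i, ∑ j, π i j = μ i) :
    ∑ i, ∑ j, c (x i) (![y₁, y₂] j) * π i j =
      ∑ i, μ i * c (x i) y₂ + ∑ i, π i 0 * (c (x i) y₁ - c (x i) y₂) := by
  rw [← Finset.sum_add_distrib]
  refine Finset.sum_congr rfl fun i _ => ?_
  rw [← h i, Fin.sum_univ_two, Fin.sum_univ_two]
  simp
  ring

/-- If the cost difference is, up to an error `η`, an affine function of a natural number `S i`, then
the optimal transport distance to two points is determined up to `η` by the distribution of `S`. -/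
theorem abs_optimalTransport_sub_le (hμ : ∀ i, 0 ≤ μ i) (hμ1 : ∑ i, μ i = 1) (ht : 0 ≤ t)
    (ht1 : t ≤ 1) (hS : ∀ i, S i ≤ M) {a b η : ℝ} (ha : 0 ≤ a)
    (hc : ∀ i, |c (x i) y₁ - c (x i) y₂ - a * (S i - b)| ≤ η) :
    |optimalTransport c μ x ![t, 1 - t] ![y₁, y₂] - (∑ i, μ i * c (x i) y₂ +
      a * ((M - b) * t - ∑ s ∈ Finset.range M, min t (∑ i, if S i < s + 1 then μ i else 0)))| ≤ η := by
  have hη : 0 ≤ η := by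
    rcases isEmpty_or_nonempty I with h | ⟨⟨i⟩⟩
    · simp at hμ1
    · exact (abs_nonneg _).trans (hc i)
  -- For each fixed first column, exact and rounded costs differ by at most `t * η`; the layer-cake
  -- formula rewrites the rounded cost.
  have hdiff : ∀ φ : I → ℝ, (∀ i, 0 ≤ φ i) → ∑ i, φ i = t →
      |∑ i, φ i * (c (x i) y₁ - c (x i) y₂) - a * ((M - b) * t -
        ∑ s ∈ Finset.range M, ∑ i, if S i < s + 1 then φ i else 0)| ≤ η := by
    intro φ h0 h1
    have e : a * ((M - b) * t - ∑ s ∈ Finset.range M, ∑ i, if S i < s + 1 then φ i else 0) =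
        ∑ i, φ i * (a * (S i - b)) := by
      have h2 := sum_mul_natCast_eq hS h1
      have h3 : ∑ i, φ i * (a * (S i - b)) = a * (∑ i, φ i * (S i : ℝ) - b * ∑ i, φ i) := by
        rw [Finset.mul_sum, ← Finset.sum_sub_distrib, Finset.mul_sum]
        exact Finset.sum_congr rfl fun i _ => by ring
      rw [h3, h2, h1]
      ring
    rw [e, ← Finset.sum_sub_distrib]
    calc _ ≤ ∑ i, |φ i * (c (x i) y₁ - c (x i) y₂) - φ i * (a * (S i - b))| :=
          Finset.abs_sum_le_sum_abs _ _
      _ ≤ ∑ i, φ i * η := by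
          refine Finset.sum_le_sum fun i _ => ?_
          rw [← mul_sub, abs_mul, abs_of_nonneg (h0 i)]
          exact mul_le_mul_of_nonneg_left (hc i) (h0 i)
      _ = t * η := by rw [← Finset.sum_mul, h1]
      _ ≤ η := mul_le_of_le_one_left hη ht1
  set v := ∑ i, μ i * c (x i) y₂ + a * ((M - b) * t - ∑ s ∈ Finset.range M,
    min t (∑ i, if S i < s + 1 then μ i else 0)) with hv
  have hlow : ∀ w ∈ (fun π : I → Fin 2 → ℝ => ∑ i, ∑ j, c (x i) (![y₁, y₂] j) * π i j) ''
      transportPlans μ ![t, 1 - t], v - η ≤ w := by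
    rintro w ⟨π, ⟨h0, h1, h2⟩, rfl⟩
    have hφ : ∑ i, π i 0 = t := h2 0
    have hle : ∀ i, π i 0 ≤ μ i := fun i => by
      rw [← h1 i, Fin.sum_univ_two]
      linarith [h0 i 1]
    have hd := (abs_le.1 (hdiff (fun i => π i 0) (fun i => h0 i 0) hφ)).1
    -- Any admissible first column puts on `S ≤ s` at most its total mass `t` and at most the
    -- `μ`-mass.
    have hm : ∑ s ∈ Finset.range M, (∑ i, if S i < s + 1 then π i 0 else 0) ≤
        ∑ s ∈ Finset.range M, min t (∑ i, if S i < s + 1 then μ i else 0) := by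
      refine Finset.sum_le_sum fun s _ => le_min ?_ ?_
      · rw [← hφ]
        refine Finset.sum_le_sum fun i _ => ?_
        split_ifs
        exacts [le_rfl, h0 i 0]
      · refine Finset.sum_le_sum fun i _ => ?_
        split_ifs
        exacts [hle i, le_rfl]
    have hm' := mul_le_mul_of_nonneg_left hm ha
    simp only
    rw [transport_cost_eq h1]
    rw [mul_sub] at hd hv
    linarith
  obtain ⟨φ, h0, h1, h2, h3⟩ := exists_greedy hμ hμ1 ht ht1 S
  -- Completed by the remaining mass, the greedy column is a plan with equality at all levels, which
  -- gives the matching upper bound.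
  have hplan : (fun i => ![φ i, μ i - φ i]) ∈ transportPlans μ ![t, 1 - t] := by
    refine ⟨fun i j => ?_, fun i => ?_, fun j => ?_⟩
    · fin_cases j
      exacts [h0 i, sub_nonneg.2 (h1 i)]
    · simp
    · fin_cases j
      · exact h2
      · simp [h2, hμ1]
  have hmem := Set.mem_image_of_mem
    (fun π : I → Fin 2 → ℝ => ∑ i, ∑ j, c (x i) (![y₁, y₂] j) * π i j) hplan
  have hup := csInf_le ⟨v - η, hlow⟩ hmem
  have hlow' := le_csInf ⟨_, hmem⟩ hlow
  have hd := (abs_le.1 (hdiff φ h0 h2)).2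
  simp only [h3] at hd
  rw [transport_cost_eq hplan.2.1] at hup
  simp only [Matrix.cons_val_zero] at hup
  unfold optimalTransport
  rw [abs_le]
  constructor <;> linarith

/-- The independent coupling is a plan, and its cost is an average of costs at most `B`. This
justifies the answer 0 when `B ≤ ε`. -/
theorem optimalTransport_mem_Icc (hμ : ∀ i, 0 ≤ μ i) (hμ1 : ∑ i, μ i = 1) (ht : 0 ≤ t)
    (ht1 : t ≤ 1) {B : ℝ} (hc0 : ∀ u v, 0 ≤ c u v) (hc₁ : ∀ i, c (x i) y₁ ≤ B)
    (hc₂ : ∀ i, c (x i) y₂ ≤ B) :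
    optimalTransport c μ x ![t, 1 - t] ![y₁, y₂] ∈ Set.Icc 0 B := by
  have hlow : ∀ w ∈ (fun π : I → Fin 2 → ℝ => ∑ i, ∑ j, c (x i) (![y₁, y₂] j) * π i j) ''
      transportPlans μ ![t, 1 - t], 0 ≤ w := by
    rintro w ⟨π, ⟨h0, -, -⟩, rfl⟩
    exact Finset.sum_nonneg fun i _ => Finset.sum_nonneg fun j _ => mul_nonneg (hc0 _ _) (h0 i j)
  have hplan : (fun i => ![μ i * t, μ i * (1 - t)]) ∈ transportPlans μ ![t, 1 - t] := by
    refine ⟨fun i j => ?_, fun i => ?_, fun j => ?_⟩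
    · fin_cases j
      exacts [mul_nonneg (hμ i) ht, mul_nonneg (hμ i) (sub_nonneg.2 ht1)]
    · simp
      ring
    · fin_cases j
      · simp [← Finset.sum_mul, hμ1]
      · simp [← Finset.sum_mul, hμ1]
  have hmem := Set.mem_image_of_mem
    (fun π : I → Fin 2 → ℝ => ∑ i, ∑ j, c (x i) (![y₁, y₂] j) * π i j) hplan
  refine ⟨le_csInf ⟨_, hmem⟩ hlow, (csInf_le ⟨0, hlow⟩ hmem).trans ?_⟩
  calc _ ≤ ∑ i, μ i * B := by
        refine Finset.sum_le_sum fun i _ => ?_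
        rw [Fin.sum_univ_two]
        simp only [Matrix.cons_val_zero, Matrix.cons_val_one]
        nlinarith [mul_le_mul_of_nonneg_left (hc₁ i) (mul_nonneg (hμ i) ht),
          mul_le_mul_of_nonneg_left (hc₂ i) (mul_nonneg (hμ i) (sub_nonneg.2 ht1))]
    _ = B := by rw [← Finset.sum_mul, hμ1, one_mul]

end TwoPoint

/-! ### Correctness of the computed value -/

/-- The mean of a function of one coordinate under a product distribution. -/
theorem sum_prod_mul_apply {K L : ℕ} (p : Fin K → Fin L → ℝ) (hp : ∀ k, ∑ l, p k l = 1) (k : Fin K)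
    (f : Fin L → ℝ) : ∑ i : Fin K → Fin L, (∏ κ, p κ (i κ)) * f (i k) = ∑ l, p k l * f l := by
  -- The function is attached to the `k`-th factor, so that the sum over all atoms factors; the
  -- other factors sum to 1.
  have h := Finset.prod_univ_sum (fun _ : Fin K => (Finset.univ : Finset (Fin L)))
    (fun κ l => p κ l * if κ = k then f l else 1)
  rw [Fintype.piFinset_univ] at h
  calc _ = ∑ i : Fin K → Fin L, ∏ κ, p κ (i κ) * (if κ = k then f (i κ) else 1) := by
        refine Finset.sum_congr rfl fun i _ => ?_
        rw [Finset.prod_mul_distrib, Finset.prod_ite_eq' Finset.univ k fun κ => f (i κ),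
          if_pos (Finset.mem_univ k)]
    _ = ∏ κ, ∑ l, p κ l * (if κ = k then f l else 1) := h.symm
    _ = _ := by
        rw [Finset.prod_eq_single k]
        · simp
        · intro κ _ hκ
          simp [hκ, hp]
        · simp

theorem sum_prod_eq_one {K L : ℕ} (p : Fin K → Fin L → ℝ) (hp : ∀ k, ∑ l, p k l = 1) :
    ∑ i : Fin K → Fin L, ∏ κ, p κ (i κ) = 1 := by
  have h := Finset.prod_univ_sum (fun _ : Fin K => (Finset.univ : Finset (Fin L))) p
  rw [Fintype.piFinset_univ] at h
  rw [← h]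
  simp [hp]

theorem norm_sub_ratPoint_sq {K : ℕ} (v w : Fin K → ℚ) :
    ‖ratPoint v - ratPoint w‖ ^ 2 = ((∑ k, (v k - w k) * (v k - w k) : ℚ) : ℝ) := by
  rw [EuclideanSpace.norm_sq_eq]
  push_cast
  refine Finset.sum_congr rfl fun k _ => ?_
  simp [ratPoint, pow_two]

theorem sum_range_mul_eq {α : Type*} [AddCommMonoid α] (K L : ℕ) (f : ℕ → α) :
    ∑ n ∈ Finset.range (K * L), f n = ∑ k : Fin K, ∑ l : Fin L, f (k * L + l) := by
  rw [Finset.sum_range, ← finProdFinEquiv.sum_comp, Fintype.sum_prod_type]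
  refine Finset.sum_congr rfl fun k _ => Finset.sum_congr rfl fun l _ => ?_
  congr 1
  simp [finProdFinEquiv]
  ring

namespace FlatInstance

variable {D : FlatInstance}

/-- The sum of the grid points of the atoms selected by `i`. -/
def gridSum (D : FlatInstance) (V : ℚ) (N : ℕ) {k : ℕ} (i : Fin k → Fin D.L) : ℕ :=
  ∑ κ : Fin k, D.grid V N (κ * D.L + i κ)

/-- Induction on the number of marginals, splitting off the last coordinate. The bound on the grid
points ensures that the sum over `2 * N + 1` bins loses no atom. -/
theorem sumMass_eq {V : ℚ} {N : ℕ} (hgrid : ∀ n < D.K * D.L, D.grid V N n ≤ 2 * N) {k : ℕ}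
    (hk : k ≤ D.K) (j : ℕ) :
    D.sumMass V N k j = ∑ i : Fin k → Fin D.L,
      if j + D.gridSum V N i = 2 * N * D.K then ∏ κ : Fin k, D.p (κ * D.L + i κ) else 0 := by
  induction k generalizing j with
  | zero => simp [sumMass, gridSum]
  | succ k ih =>
    have h1 : D.sumMass V N (k + 1) j = ∑ l ∈ Finset.range D.L,
        D.p (k * D.L + l) * D.sumMass V N k (j + D.grid V N (k * D.L + l)) := by
      simp only [sumMass, binMass, Finset.sum_mul]
      rw [Finset.sum_comm]
      refine Finset.sum_congr rfl fun l hl => ?_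
      have hlt : k * D.L + l < D.K * D.L :=
        calc k * D.L + l < k * D.L + D.L := by
              have := Finset.mem_range.1 hl
              omega
          _ = (k + 1) * D.L := (Nat.succ_mul _ _).symm
          _ ≤ _ := Nat.mul_le_mul_right _ hk
      simp only [ite_mul, zero_mul]
      rw [Finset.sum_ite_eq' (Finset.range (2 * N + 1)) (D.grid V N (k * D.L + l)) fun a =>
        D.p (k * D.L + l) * D.sumMass V N k (j + a),
        if_pos (Finset.mem_range.2 (Nat.lt_succ_of_le (hgrid _ hlt)))]
    rw [h1, Finset.sum_range, ← (Fin.snocEquiv fun _ => Fin D.L).sum_comp, Fintype.sum_prod_type]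
    refine Finset.sum_congr rfl fun l _ => ?_
    rw [ih (by omega), Finset.mul_sum]
    refine Finset.sum_congr rfl fun i _ => ?_
    rw [mul_ite, mul_zero]
    refine if_congr ?_ ?_ rfl
    · simp only [gridSum, Fin.snocEquiv_apply, Fin.sum_univ_castSucc, Fin.snoc_castSucc,
        Fin.snoc_last, Fin.val_castSucc, Fin.val_last]
      rw [add_assoc, add_comm (D.grid _ _ _)]
    · simp only [Fin.snocEquiv_apply, Fin.prod_univ_castSucc, Fin.snoc_castSucc, Fin.snoc_last,
        Fin.val_castSucc, Fin.val_last]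
      rw [mul_comm]

theorem gridSum_le {V : ℚ} {N : ℕ} (hgrid : ∀ n < D.K * D.L, D.grid V N n ≤ 2 * N)
    (i : Fin D.K → Fin D.L) : D.gridSum V N i ≤ 2 * N * D.K := by
  calc D.gridSum V N i ≤ ∑ _κ : Fin D.K, 2 * N := Finset.sum_le_sum fun κ _ => hgrid _ ?_
    _ = _ := by simp [mul_comm]
  calc κ * D.L + i κ < κ * D.L + D.L := by omega
    _ = (κ + 1) * D.L := (Nat.succ_mul _ _).symm
    _ ≤ _ := Nat.mul_le_mul_right _ κ.2

theorem cumMass_eq {V : ℚ} {N : ℕ} (hgrid : ∀ n < D.K * D.L, D.grid V N n ≤ 2 * N) {n : ℕ}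
    (hn : n ≤ 2 * N * D.K) :
    D.cumMass V N n = ∑ i : Fin D.K → Fin D.L,
      if D.gridSum V N i < n then ∏ κ : Fin D.K, D.p (κ * D.L + i κ) else 0 := by
  unfold cumMass
  simp only [sumMass_eq hgrid le_rfl]
  rw [Finset.sum_comm]
  refine Finset.sum_congr rfl fun i _ => ?_
  -- As `s < n ≤ 2 * N * D.K`, the truncated subtraction is an honest one.
  have h : ∀ s ∈ Finset.range n, (if 2 * N * D.K - s + D.gridSum V N i = 2 * N * D.K then
      ∏ κ : Fin D.K, D.p (κ * D.L + i κ) else 0) =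
      if s = D.gridSum V N i then ∏ κ : Fin D.K, D.p (κ * D.L + i κ) else 0 := by
    intro s hs
    have := Finset.mem_range.1 hs
    refine if_congr ⟨fun h => ?_, fun h => ?_⟩ rfl rfl <;> omega
  rw [Finset.sum_congr rfl h, Finset.sum_ite_eq']
  simp only [Finset.mem_range]

/-- Rounding down moves the rescaled gap by less than one grid cell, and a cell has width `V / N`.
-/
theorem abs_gap_sub_le {V : ℚ} (hV : 0 < V) {N n : ℕ} (hN : 0 < N) (h : |D.gap n| ≤ V) :
    |D.gap n - V / N * (D.grid V N n - N)| ≤ V / N := by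
  have hN' : (0 : ℚ) < N := by exact_mod_cast hN
  have h1 := Nat.floor_le (grid_nonneg_aux hV N h).1
  have h2 := Nat.lt_floor_add_one (D.gap n * N / V + N)
  have e : D.gap n = V / N * (D.gap n * N / V) := by
    field_simp
  have hVN : 0 < V / N := div_pos hV hN'
  change ((D.grid V N n : ℕ) : ℚ) ≤ _ at h1
  change _ < ((D.grid V N n : ℕ) : ℚ) + 1 at h2
  generalize (D.grid V N n : ℚ) = G at *
  generalize D.gap n * N / V = H at *
  rw [e, ← mul_sub, abs_mul, abs_of_pos hVN]
  refine mul_le_of_le_one_right hVN.le (abs_le.2 ⟨?_, ?_⟩) <;> linarith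

end FlatInstance

/-! ### The instance read off the input memory, and the error of the computed value -/

namespace RatRam

open FlatInstance

variable {K L : ℕ} (p x : Fin K → Fin L → ℚ) (y₁ y₂ : Fin K → ℚ) (t ε : ℚ)

/-- The flat form of an instance. -/
def flatInstance : FlatInstance where
  K := K
  L := L
  p := (inputState p x y₁ y₂ t ε).arr 0
  x := (inputState p x y₁ y₂ t ε).arr 1
  y := (inputState p x y₁ y₂ t ε).arr 2
  z := (inputState p x y₁ y₂ t ε).arr 3
  t := t
  ε := ε

theorem holds_inputState :
    Holds (flatInstance p x y₁ y₂ t ε) (inputState p x y₁ y₂ t ε) := by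
  constructor <;> rfl

variable {p x y₁ y₂ t ε}

theorem atom_lt (k : Fin K) (l : Fin L) : (k : ℕ) * L + l < K * L :=
  calc k * L + l < k * L + L := by omega
    _ = (k + 1) * L := (Nat.succ_mul _ _).symm
    _ ≤ _ := Nat.mul_le_mul_right _ k.2

theorem finProdFinEquiv_symm_atom (k : Fin K) (l : Fin L) :
    finProdFinEquiv.symm ⟨k * L + l, atom_lt k l⟩ = (k, l) := by
  rw [Equiv.symm_apply_eq]
  ext
  simp [finProdFinEquiv]
  ring

theorem flatInstance_p (k : Fin K) (l : Fin L) :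
    (flatInstance p x y₁ y₂ t ε).p (k * L + l) = p k l := by
  change (if h : (k * L + l : ℕ) < K * L then
    p (finProdFinEquiv.symm ⟨k * L + l, h⟩).1 (finProdFinEquiv.symm ⟨k * L + l, h⟩).2 else 0) = _
  rw [dif_pos (atom_lt k l), finProdFinEquiv_symm_atom]

theorem flatInstance_x (k : Fin K) (l : Fin L) :
    (flatInstance p x y₁ y₂ t ε).x (k * L + l) = x k l := by
  change (if h : (k * L + l : ℕ) < K * L then
    x (finProdFinEquiv.symm ⟨k * L + l, h⟩).1 (finProdFinEquiv.symm ⟨k * L + l, h⟩).2 else 0) = _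
  rw [dif_pos (atom_lt k l), finProdFinEquiv_symm_atom]

theorem atom_div (k : Fin K) (l : Fin L) : ((k : ℕ) * L + l) / L = k := by
  rw [mul_comm, Nat.mul_add_div l.pos, Nat.div_eq_of_lt l.2, add_zero]

theorem flatInstance_y (k : Fin K) (l : Fin L) :
    (flatInstance p x y₁ y₂ t ε).y ((k * L + l) / (flatInstance p x y₁ y₂ t ε).L) = y₁ k := by
  simp [flatInstance, inputState, atom_div]

theorem flatInstance_z (k : Fin K) (l : Fin L) :
    (flatInstance p x y₁ y₂ t ε).z ((k * L + l) / (flatInstance p x y₁ y₂ t ε).L) = y₂ k := by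
  simp [flatInstance, inputState, atom_div]

/-- Unused cells contain 0, so a property shared by 0 and the data holds at every address. -/
theorem flatInstance_forall {P : ℚ → Prop} (h0 : P 0) (hp : ∀ k l, P (p k l)) (n : ℕ) :
    P ((flatInstance p x y₁ y₂ t ε).p n) := by
  simp only [flatInstance, inputState]
  split_ifs
  exacts [hp _ _, h0]

theorem flatInstance_forall_x {P : ℚ → Prop} (h0 : P 0) (hx : ∀ k l, P (x k l)) (n : ℕ) :
    P ((flatInstance p x y₁ y₂ t ε).x n) := by
  simp only [flatInstance, inputState]
  split_ifs
  exacts [hx _ _, h0]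

theorem flatInstance_forall_y {P : ℚ → Prop} (h0 : P 0) (hy : ∀ k, P (y₁ k)) (n : ℕ) :
    P ((flatInstance p x y₁ y₂ t ε).y n) := by
  simp only [flatInstance, inputState]
  split_ifs
  exacts [hy _, h0]

theorem flatInstance_forall_z {P : ℚ → Prop} (h0 : P 0) (hy : ∀ k, P (y₂ k)) (n : ℕ) :
    P ((flatInstance p x y₁ y₂ t ε).z n) := by
  simp only [flatInstance, inputState]
  split_ifs
  exacts [hy _, h0]

section Correct

variable (hp : ∀ k l, 0 ≤ p k l) (hp1 : ∀ k, ∑ l, p k l = 1) (ht : 0 ≤ t) (ht1 : t ≤ 1) {V : ℚ}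
  (hV : (flatInstance p x y₁ y₂ t ε).IsMaxSqSum (K * L) V)
include hp hp1 ht ht1 hV

/-- Each coordinate contributes at most `V` to either cost, because `V` bounds the sum of both
squares. -/
theorem productTwoPointOT_mem_Icc : productTwoPointOT p x y₁ y₂ t ∈ Set.Icc 0 ((K * V : ℚ) : ℝ) := by
  have hle : ∀ (k : Fin K) (l : Fin L),
      (x k l - y₁ k) * (x k l - y₁ k) + (x k l - y₂ k) * (x k l - y₂ k) ≤ V := by
    intro k l
    have h := hV.le _ (atom_lt k l)
    rwa [sqSum, flatInstance_x, flatInstance_y, flatInstance_z] at h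
  refine optimalTransport_mem_Icc (fun i => Finset.prod_nonneg fun k _ => by exact_mod_cast hp _ _)
    (sum_prod_eq_one (fun k l => (p k l : ℝ)) fun k => by exact_mod_cast hp1 k)
    (by exact_mod_cast ht) (by exact_mod_cast ht1) (fun u v => by positivity) (fun i => ?_)
    fun i => ?_
  all_goals
    rw [norm_sub_ratPoint_sq]
    norm_cast
    calc _ ≤ ∑ _k : Fin K, V := Finset.sum_le_sum fun k _ => ?_
      _ = _ := by simp
    nlinarith [hle k (i k), mul_self_nonneg (x k (i k) - y₁ k), mul_self_nonneg (x k (i k) - y₂ k)]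

/-- The two-point estimate is applied with slope `V / N`, offset `b = K * N` and `M = 2 * N * K`, so
that `M - b = K * N` is the coefficient of `t`. The `K` rounding errors add up to `K * V / N`. -/
theorem abs_approxValue_sub_le (hV0 : 0 < V) {N : ℕ} (hN : 0 < N) (hε : K * V / N ≤ ε) :
    |(((flatInstance p x y₁ y₂ t ε).approxValue V N : ℚ) : ℝ) - productTwoPointOT p x y₁ y₂ t| ≤
      ε := by
  set D := flatInstance p x y₁ y₂ t ε with hD
  have hgap : ∀ n < K * L, |D.gap n| ≤ V := fun n hn => (gap_abs_le n).trans (hV.le n hn)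
  have hgrid : ∀ n < D.K * D.L, D.grid V N n ≤ 2 * N := fun n hn => grid_le hV0 N (hgap n hn)
  have hcost : ∀ i : Fin K → Fin L,
      ‖ratPoint (fun k => x k (i k)) - ratPoint y₁‖ ^ 2 -
        ‖ratPoint (fun k => x k (i k)) - ratPoint y₂‖ ^ 2 =
      ((∑ k : Fin K, D.gap (k * L + i k) : ℚ) : ℝ) := by
    intro i
    rw [norm_sub_ratPoint_sq, norm_sub_ratPoint_sq, ← Rat.cast_sub, ← Finset.sum_sub_distrib]
    congr 1
    refine Finset.sum_congr rfl fun k _ => ?_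
    rw [gap, hD, flatInstance_x, flatInstance_y, flatInstance_z]
  have hc : ∀ i : Fin K → Fin L,
      |‖ratPoint (fun k => x k (i k)) - ratPoint y₁‖ ^ 2 -
        ‖ratPoint (fun k => x k (i k)) - ratPoint y₂‖ ^ 2 -
        ((V / N : ℚ) : ℝ) * ((D.gridSum V N (k := K) i : ℕ) - ((K * N : ℚ) : ℝ))| ≤ (ε : ℝ) := by
    intro i
    rw [hcost]
    norm_cast
    refine le_trans ?_ hε
    have e : ∑ k : Fin K, D.gap (k * L + i k) - V / N * ((D.gridSum V N (k := K) i : ℕ) - K * N) =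
        ∑ k : Fin K, (D.gap (k * L + i k) - V / N * (D.grid V N (k * L + i k) - N)) := by
      have : ((D.gridSum V N (k := K) i : ℕ) : ℚ) = ∑ k : Fin K, (D.grid V N (k * L + i k) : ℚ) := by
        change ((∑ k : Fin K, D.grid V N (k * L + i k) : ℕ) : ℚ) = _
        push_cast
        rfl
      rw [this, Finset.sum_sub_distrib, ← Finset.mul_sum, Finset.sum_sub_distrib]
      simp
    calc _ = |∑ k : Fin K, (D.gap (k * L + i k) - V / N * (D.grid V N (k * L + i k) - N))| := by
          rw [← e]
          push_cast
          rfl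
      _ ≤ ∑ k : Fin K, |D.gap (k * L + i k) - V / N * (D.grid V N (k * L + i k) - N)| :=
          Finset.abs_sum_le_sum_abs _ _
      _ ≤ ∑ _k : Fin K, V / N :=
          Finset.sum_le_sum fun k _ => abs_gap_sub_le hV0 hN (hgap _ (atom_lt k (i k)))
      _ = K * V / N := by
          simp
          ring
  have hp1' : ∀ k, ∑ l, (p k l : ℝ) = 1 := fun k => by exact_mod_cast hp1 k
  have hmain := abs_optimalTransport_sub_le (I := Fin K → Fin L)
    (c := fun u v : EuclideanSpace ℝ (Fin K) => ‖u - v‖ ^ 2)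
    (x := fun i => ratPoint (fun k => x k (i k))) (y₁ := ratPoint y₁) (y₂ := ratPoint y₂)
    (μ := fun i => ∏ k, (p k (i k) : ℝ)) (S := fun i => D.gridSum V N (k := K) i)
    (fun i => Finset.prod_nonneg fun k _ => by exact_mod_cast hp _ _)
    (sum_prod_eq_one (fun k l => (p k l : ℝ)) hp1')
    (show (0 : ℝ) ≤ t by exact_mod_cast ht) (show (t : ℝ) ≤ 1 by exact_mod_cast ht1)
    (fun i => gridSum_le hgrid i) (show (0 : ℝ) ≤ ((V / N : ℚ) : ℝ) by
      exact_mod_cast (div_nonneg hV0.le N.cast_nonneg)) hc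
  have hmean : ∑ i : Fin K → Fin L, (∏ k, (p k (i k) : ℝ)) *
      ‖ratPoint (fun k => x k (i k)) - ratPoint y₂‖ ^ 2 = ((D.meanCost (D.K * D.L) : ℚ) : ℝ) := by
    have h1 : ∀ i : Fin K → Fin L, (∏ k, (p k (i k) : ℝ)) *
        ‖ratPoint (fun k => x k (i k)) - ratPoint y₂‖ ^ 2 = ∑ k, (∏ κ, (p κ (i κ) : ℝ)) *
          (((x k (i k) - y₂ k) * (x k (i k) - y₂ k) : ℚ) : ℝ) := by
      intro i
      rw [norm_sub_ratPoint_sq, Rat.cast_sum, Finset.mul_sum]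
    simp only [h1]
    rw [Finset.sum_comm, meanCost, sum_range_mul_eq, Rat.cast_sum]
    refine Finset.sum_congr rfl fun k _ => ?_
    rw [sum_prod_mul_apply (fun k l => (p k l : ℝ)) hp1' k fun l =>
      (((x k l - y₂ k) * (x k l - y₂ k) : ℚ) : ℝ), Rat.cast_sum]
    refine Finset.sum_congr rfl fun l _ => ?_
    rw [← Rat.cast_mul]
    congr 1
    change _ = D.p (k * L + l) * ((D.x (k * L + l) - D.z ((k * L + l) / D.L)) *
      (D.x (k * L + l) - D.z ((k * L + l) / D.L)))
    rw [hD, flatInstance_p, flatInstance_x, flatInstance_z]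
  have htrunc : ∑ s ∈ Finset.range (2 * N * D.K), min (t : ℝ) (∑ i : Fin K → Fin L,
      if D.gridSum V N (k := K) i < s + 1 then ∏ k, (p k (i k) : ℝ) else 0) =
      ((D.truncSum V N (2 * N * D.K) : ℚ) : ℝ) := by
    rw [truncSum, Rat.cast_sum]
    refine Finset.sum_congr rfl fun s hs => ?_
    rw [cumMass_eq hgrid (show s + 1 ≤ _ from Finset.mem_range.1 hs), Rat.cast_min]
    congr 1
    rw [Rat.cast_sum]
    refine Finset.sum_congr rfl fun i _ => ?_
    refine (if_congr Iff.rfl ?_ ?_).trans (apply_ite (fun q : ℚ => (q : ℝ)) _ _ _).symm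
    · rw [Rat.cast_prod]
      refine Finset.prod_congr rfl fun k _ => ?_
      congr 1
      exact (flatInstance_p k (i k)).symm
    · simp
  rw [hmean, htrunc] at hmain
  rw [abs_sub_comm]
  unfold productTwoPointOT
  convert hmain using 3
  rw [approxValue]
  push_cast
  rw [show (D.K : ℝ) = K from rfl, show D.t = t from rfl]
  ring

end Correct

end RatRam

/-! ### Bounds in terms of `U` and `ε` -/

theorem IsFractionBoundedBy.abs_le {U : ℕ} {q : ℚ} (h : IsFractionBoundedBy U q) : |q| ≤ U := by
  obtain ⟨a, b, hb, ha, -, rfl⟩ := h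
  have hb1 : (1 : ℚ) ≤ |(b : ℚ)| := by exact_mod_cast Int.one_le_abs hb
  rw [abs_div]
  exact (div_le_self (abs_nonneg _) hb1).trans (by exact_mod_cast ha)

theorem IsFractionBoundedBy.one_le {U : ℕ} {q : ℚ} (h : IsFractionBoundedBy U q) : 1 ≤ U := by
  obtain ⟨a, b, hb, -, hb', -⟩ := h
  have := Int.one_le_abs hb
  omega

namespace RatRam

open FlatInstance

variable {K L : ℕ} {p x : Fin K → Fin L → ℚ} {y₁ y₂ : Fin K → ℚ} {t ε : ℚ} {U : ℕ}

theorem flatInstance_isValid (hK : 1 ≤ K) (hL : 1 ≤ L) (hp : ∀ k l, 0 ≤ p k l)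
    (hp1 : ∀ k, ∑ l, p k l = 1) (ht : 0 ≤ t) (ht1 : t ≤ 1)
    (hpU : ∀ k l, IsFractionBoundedBy U (p k l)) (hxU : ∀ k l, IsFractionBoundedBy U (x k l))
    (hy₁ : ∀ k, IsFractionBoundedBy U (y₁ k)) (hy₂ : ∀ k, IsFractionBoundedBy U (y₂ k))
    (htU : IsFractionBoundedBy U t) {u : ℕ} (hu : U ≤ 2 ^ u) :
    (flatInstance p x y₁ y₂ t ε).IsValid u where
  K_pos := hK
  L_pos := hL
  p_nonneg := flatInstance_forall le_rfl hp
  p_sum k hk := by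
    rw [Finset.sum_range, ← hp1 ⟨k, hk⟩]
    exact Finset.sum_congr rfl fun l _ => flatInstance_p ⟨k, hk⟩ l
  t_nonneg := ht
  t_le := ht1
  p_fits := flatInstance_forall .zero fun k l => (hpU k l).fitsBits hu
  x_fits := flatInstance_forall_x .zero fun k l => (hxU k l).fitsBits hu
  y_fits := flatInstance_forall_y .zero fun k => (hy₁ k).fitsBits hu
  z_fits := flatInstance_forall_z .zero fun k => (hy₂ k).fitsBits hu
  t_fits := htU.fitsBits hu

/-- Coordinates are at most `U` in absolute value, so each of the two squares is at most `4 * U ^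
2`. -/
theorem maxSqSum_le (hxU : ∀ k l, IsFractionBoundedBy U (x k l))
    (hy₁ : ∀ k, IsFractionBoundedBy U (y₁ k)) (hy₂ : ∀ k, IsFractionBoundedBy U (y₂ k)) {V : ℚ}
    {n : ℕ} (hV : (flatInstance p x y₁ y₂ t ε).IsMaxSqSum n V) : V ≤ 8 * U ^ 2 := by
  have hU : (0 : ℚ) ≤ U := U.cast_nonneg
  rcases hV.eq with rfl | ⟨i, -, rfl⟩
  · positivity
  · have hsq : ∀ a b : ℚ, |a| ≤ U → |b| ≤ U → (a - b) * (a - b) ≤ 4 * U ^ 2 := by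
      intro a b ha hb
      rw [abs_le] at ha hb
      nlinarith
    have h0 : |(0 : ℚ)| ≤ U := by simp
    have h1 := flatInstance_forall_x (P := fun q => |q| ≤ (U : ℚ)) (p := p) (y₁ := y₁) (y₂ := y₂)
      (t := t) (ε := ε) h0 (fun k l => (hxU k l).abs_le) i
    have h2 := hsq _ _ h1 (flatInstance_forall_y (P := fun q => |q| ≤ (U : ℚ)) (p := p) (x := x)
      (y₂ := y₂) (t := t) (ε := ε) h0 (fun k => (hy₁ k).abs_le)
      (i / (flatInstance p x y₁ y₂ t ε).L))
    have h3 := hsq _ _ h1 (flatInstance_forall_z (P := fun q => |q| ≤ (U : ℚ)) (p := p) (x := x)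
      (y₁ := y₁) (t := t) (ε := ε) h0 (fun k => (hy₂ k).abs_le)
      (i / (flatInstance p x y₁ y₂ t ε).L))
    rw [sqSum]
    linarith

/-- The number `2 ^ m` of grid points per unit that is reached by successive doubling. -/
theorem exists_resolution {W ε : ℚ} (hε : 0 < ε) :
    ∃ m : ℕ, (∀ j < m, ε < W / 2 ^ j) ∧ W / 2 ^ m ≤ ε ∧
      ((2 : ℚ) ^ m ≤ 1 ∨ (2 : ℚ) ^ m ≤ 2 * W / ε) := by
  have hex : ∃ m : ℕ, W / 2 ^ m ≤ ε := by
    obtain ⟨m, hm⟩ := pow_unbounded_of_one_lt (W / ε) (one_lt_two : (1 : ℚ) < 2)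
    refine ⟨m, ?_⟩
    rw [div_le_iff₀ (by positivity)]
    rw [div_lt_iff₀ hε] at hm
    linarith
  refine ⟨Nat.find hex, fun j hj => not_le.1 (Nat.find_min hex hj), Nat.find_spec hex, ?_⟩
  rcases h : Nat.find hex with _ | m
  · left
    simp
  · right
    -- By minimality the previous exponent was too small; one doubling later the resolution exceeds
    -- `W / ε` by at most the factor 2.
    have hlt := not_le.1 (Nat.find_min hex (m := m) (by omega))
    rw [lt_div_iff₀ (by positivity)] at hlt
    rw [le_div_iff₀ hε, pow_succ]
    linarith

/-- Taking logarithms, 4 is that of 16, and that of `K` is crudely replaced by `K`, which a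
polynomial bound tolerates. -/
theorem natCast_le_of_two_pow_le {K U m : ℕ} (hK : 1 ≤ K) (hU : 1 ≤ U) {ε : ℝ} (hε : 0 < ε)
    (h : (2 : ℝ) ^ m ≤ 1 ∨ (2 : ℝ) ^ m ≤ 16 * K * U ^ 2 / ε) :
    (m : ℝ) ≤ 4 + K + 2 * Real.logb 2 U + max 0 (Real.logb 2 (1 / ε)) := by
  have hK0 : (0 : ℝ) < K := by exact_mod_cast hK
  have hU0 : (0 : ℝ) < U := by exact_mod_cast hU
  have hlU : 0 ≤ Real.logb 2 U := Real.logb_nonneg one_lt_two (by exact_mod_cast hU)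
  have hm : Real.logb 2 ((2 : ℝ) ^ m) = m := by
    rw [Real.logb_pow, Real.logb_self_eq_one one_lt_two, mul_one]
  rcases h with h | h
  · have := Real.logb_le_logb_of_le one_lt_two (by positivity) h
    rw [hm, Real.logb_one] at this
    linarith [le_max_left 0 (Real.logb 2 (1 / ε))]
  · have h1 := Real.logb_le_logb_of_le one_lt_two (by positivity) h
    have hlK : Real.logb 2 K ≤ K := by
      rw [Real.logb_le_iff_le_rpow one_lt_two hK0, Real.rpow_natCast]
      exact_mod_cast Nat.lt_two_pow_self.le
    have h16 : Real.logb 2 (16 : ℝ) = 4 := by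
      rw [show (16 : ℝ) = 2 ^ (4 : ℕ) by norm_num, Real.logb_pow, Real.logb_self_eq_one one_lt_two]
      norm_num
    rw [hm, div_eq_mul_one_div, Real.logb_mul (by positivity) (by positivity),
      Real.logb_mul (by positivity) (by positivity), Real.logb_mul (by positivity) (by positivity),
      Real.logb_pow, h16] at h1
    push_cast at h1
    linarith [le_max_right 0 (Real.logb 2 (1 / ε))]

theorem clog_le_logb_add_one {U : ℕ} (hU : 1 ≤ U) :
    (Nat.clog 2 U : ℝ) ≤ Real.logb 2 U + 1 := by
  have hU0 : (1 : ℝ) ≤ U := by exact_mod_cast hU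
  rw [← Real.natCeil_logb_natCast]
  exact (Nat.ceil_lt_add_one (Real.logb_nonneg (by norm_num) hU0)).le

/-- The linear scan is absorbed by the logarithmic term as soon as `n ≥ 2`; for `n = 1` the
logarithm vanishes and the summand 1 is needed. -/
theorem mul_le_mul_logb_add_one {n : ℕ} (hn : 1 ≤ n) : (n : ℝ) ≤ n * Real.logb 2 n + 1 := by
  rcases hn.eq_or_lt with rfl | h
  · simp
  · have h1 : 1 ≤ Real.logb 2 (n : ℝ) := by
      rw [← Real.logb_self_eq_one one_lt_two]
      exact Real.logb_le_logb_of_le one_lt_two two_pos (by exact_mod_cast h)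
    nlinarith [n.cast_nonneg (α := ℝ)]

end RatRam

open RatRam FlatInstance in
theorem mainTheorem3 :
    ∃ (P : RatRam.Program) (C B : ℝ) (d : ℕ),
      ∀ (K L : ℕ), 1 ≤ K → 1 ≤ L →
      ∀ (p x : Fin K → Fin L → ℚ) (y₁ y₂ : Fin K → ℚ) (t ε : ℚ) (U : ℕ),
        (∀ k l, 0 ≤ p k l) → (∀ k, ∑ l, p k l = 1) → 0 ≤ t → t ≤ 1 → 0 < ε →
        (∀ k l, IsFractionBoundedBy U (p k l)) → (∀ k l, IsFractionBoundedBy U (x k l)) →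
        (∀ k, IsFractionBoundedBy U (y₁ k)) → (∀ k, IsFractionBoundedBy U (y₂ k)) →
        IsFractionBoundedBy U t → IsFractionBoundedBy U (1 - t) →
        ∃ (n : ℕ) (T : List ℚ) (s : RatRam.State),
          RatRam.Run P (RatRam.inputState p x y₁ y₂ t ε) n T s ∧
          |(s.output : ℝ) - productTwoPointOT p x y₁ y₂ t| ≤ (ε : ℝ) ∧
          (n : ℝ) ≤ C * ((K : ℝ) * L * Real.logb 2 ((K : ℝ) * L)
            + (K : ℝ) ^ 6 * (U : ℝ) ^ 8 / (ε : ℝ) ^ 4 + 1) ∧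
          ∀ q ∈ T, (bitLength q : ℝ) ≤
            B * (1 + (K : ℝ) + L + Real.logb 2 U + max 0 (Real.logb 2 (1 / (ε : ℝ)))) ^ d := by
  -- The coefficient of `K ^ 2 * w ^ 4` below is 300 · 16384 = 4915200. The bit bound is `200 * β +
  -- 2` with `β ≤ 12 * Z ^ 3`; the degree 3 comes from the product `K * L * (u + 1)` in `β`.
  refine ⟨transportProgram, 5000000, 4000, 3, ?_⟩
  intro K L hK hL p x y₁ y₂ t ε U hp hp1 ht ht1 hε hpU hxU hy₁ hy₂ htU _
  have hU : 1 ≤ U := htU.one_le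
  set u := Nat.clog 2 U with hu
  have hD := flatInstance_isValid (ε := ε) hK hL hp hp1 ht ht1 hpU hxU hy₁ hy₂ htU
    (Nat.le_pow_clog one_lt_two U)
  obtain ⟨V, hV⟩ := exists_isMaxSqSum (flatInstance p x y₁ y₂ t ε) (K * L)
  have hV8 := maxSqSum_le hxU hy₁ hy₂ hV
  obtain ⟨m, hm, hm', hm2⟩ := exists_resolution (W := K * V) hε
  set β := K * L * (u + 1) + K + L + u + m + 1 with hβdef
  have hβ : (flatInstance p x y₁ y₂ t ε).SizeBound u m β :=
    ⟨show K * L * (u + 1) ≤ β by omega, show K ≤ β by omega, show L ≤ β by omega, by omega,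
      by omega, by omega⟩
  obtain ⟨n, hn, T, s, hrun, hT, hout⟩ := transportProgram_achieves_approxValue hD hβ hε hV hm hm'
    (holds_inputState p x y₁ y₂ t ε) rfl rfl rfl rfl
  change n ≤ K * L * 58 + 7 + (if ε < K * V then 300 * (K * L + K ^ 2 * (2 ^ m) ^ 2) else 0) at hn
  change _ = if ε < K * V then _ else _ at hout
  have hK0 : (0 : ℝ) < K := by exact_mod_cast hK
  have hL0 : (0 : ℝ) < L := by exact_mod_cast hL
  have hU0 : (0 : ℝ) < U := by exact_mod_cast hU
  have hε0 : (0 : ℝ) < ε := by exact_mod_cast hε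
  have hKV : ((K * V : ℚ) : ℝ) ≤ 8 * K * U ^ 2 := by
    have : (K * V : ℚ) ≤ 8 * K * U ^ 2 := by
      nlinarith [mul_le_mul_of_nonneg_left hV8 (K.cast_nonneg (α := ℚ))]
    exact_mod_cast this
  have hm3 : (2 : ℝ) ^ m ≤ 1 ∨ (2 : ℝ) ^ m ≤ 16 * K * U ^ 2 / ε := by
    refine hm2.imp (fun h => by exact_mod_cast h) fun h => ?_
    have h' : (2 : ℝ) ^ m ≤ 2 * ((K * V : ℚ) : ℝ) / ε := by exact_mod_cast h
    exact h'.trans (div_le_div_of_nonneg_right (by linarith) hε0.le)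
  refine ⟨n, T, s, hrun, ?_, ?_, ?_⟩
  · rw [hout]
    split_ifs with hlt
    · have hV0 : 0 < V := pos_of_mul_pos_right (hε.trans hlt) (Nat.cast_nonneg _)
      refine abs_approxValue_sub_le hp hp1 ht ht1 hV hV0 (by positivity) ?_
      push_cast
      exact hm'
    · obtain ⟨h0, h1⟩ := productTwoPointOT_mem_Icc hp hp1 ht ht1 hV
      have h2 : ((K * V : ℚ) : ℝ) ≤ ε := by exact_mod_cast not_lt.1 hlt
      rw [Rat.cast_zero, zero_sub, abs_neg, abs_of_nonneg h0]
      exact h1.trans h2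
  · have hKL := mul_le_mul_logb_add_one (n := K * L) (Nat.mul_pos hK hL)
    push_cast at hKL
    have hX : 0 ≤ (K : ℝ) ^ 6 * (U : ℝ) ^ 8 / (ε : ℝ) ^ 4 := by positivity
    have hKL0 : 0 ≤ (K : ℝ) * L * Real.logb 2 ((K : ℝ) * L) := by
      refine mul_nonneg (by positivity) (Real.logb_nonneg one_lt_two ?_)
      exact_mod_cast Nat.mul_pos hK hL
    have hnR : (n : ℝ) ≤ K * L * 58 + 7 +
        (if ε < K * V then 300 * (K * L + K ^ 2 * (2 ^ m) ^ 2) else 0 : ℝ) := by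
      have := (Nat.cast_le (α := ℝ)).2 hn
      push_cast at this
      exact this
    split_ifs at hnR with hlt
    · have hlt' : (ε : ℝ) < ((K * V : ℚ) : ℝ) := by exact_mod_cast hlt
      set w : ℝ := K * U ^ 2 / ε with hw
      have hw0 : 0 < w := by positivity
      -- This uses that the grid is built only if `ε < K * V ≤ 8 * K * U ^ 2`. It covers the case `2
      -- ^ m = 1` and allows the count, quadratic in `w`, to be raised to the fourth power of the
      -- claim.
      have hw8 : 1 ≤ 8 * w := by
        rw [hw, ← mul_div_assoc, le_div_iff₀ hε0]
        linarith
      have hN : (2 : ℝ) ^ m ≤ 16 * w := by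
        rcases hm3 with h | h
        · linarith
        · refine h.trans_eq ?_
          rw [hw]
          ring
      have hXw : (K : ℝ) ^ 6 * (U : ℝ) ^ 8 / (ε : ℝ) ^ 4 = K ^ 2 * w ^ 4 := by
        rw [hw]
        field_simp
      have hsq : ((2 : ℝ) ^ m) ^ 2 ≤ 16384 * w ^ 4 := by
        calc ((2 : ℝ) ^ m) ^ 2 ≤ (16 * w) ^ 2 := pow_le_pow_left₀ (by positivity) hN 2
          _ ≤ (16 * w) ^ 2 * (8 * w) ^ 2 :=
            le_mul_of_one_le_right (by positivity) (one_le_pow₀ hw8)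
          _ = 16384 * w ^ 4 := by ring
      have hfin := mul_le_mul_of_nonneg_left hsq (sq_nonneg (K : ℝ))
      rw [hXw] at hX ⊢
      linarith
    · linarith
  · intro q hq
    have h1 : bitLength q ≤ 2 * (100 * β) + 2 := (hT q hq).bitLength_le
    have h2 : (bitLength q : ℝ) ≤ 200 * β + 2 := by
      have := (Nat.cast_le (α := ℝ)).2 h1
      push_cast at this
      linarith
    have hmR := natCast_le_of_two_pow_le hK hU hε0 hm3
    have huR := clog_le_logb_add_one hU
    have hlU : 0 ≤ Real.logb 2 (U : ℝ) := Real.logb_nonneg one_lt_two (by exact_mod_cast hU)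
    have hmax := le_max_left 0 (Real.logb 2 (1 / (ε : ℝ)))
    set Z := 1 + (K : ℝ) + L + Real.logb 2 U + max 0 (Real.logb 2 (1 / (ε : ℝ))) with hZ
    have hZ1 : 1 ≤ Z := by linarith
    have hZ3 : Z ≤ Z ^ 3 := le_self_pow₀ hZ1 (by norm_num)
    have hprod : (K : ℝ) * L * (u + 1) ≤ Z * Z * (2 * Z) := by
      refine mul_le_mul (mul_le_mul ?_ ?_ hL0.le (by linarith)) ?_ (by positivity)
        (by positivity) <;> linarith
    have hβR : (β : ℝ) = K * L * (u + 1) + K + L + u + m + 1 := by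
      rw [hβdef]
      push_cast
      ring
    have hβZ : (β : ℝ) ≤ 12 * Z ^ 3 := by
      rw [hβR]
      have : Z * Z * (2 * Z) = 2 * Z ^ 3 := by ring
      linarith
    linarith
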